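/- Let $G$ be a finite simple connected graph on $n$ vertices with maximum degree $\Delta\ge 2$, and let $\Phi=(G,\varphi)$ be a complex unit gain graph on $G$: $\varphi$ assigns to each oriented edge $\overrightarrow{uv}$ of $G$ a complex number of modulus $1$, with $\varphi(\overrightarrow{vu})=\varphi(\overrightarrow{uv})^{-1}$. Let $A(\Phi)$ be the Hermitian matrix whose $(u,v)$ entry is $\varphi(\overrightarrow{uv})$ if $u\sim v$ and $0$ otherwise, let $D$ be the diagonal matrix of vertex degrees, and for $\alpha\in[0,1)$ put $A_\alpha(\Phi)=\alpha D+(1-\alpha)A(\Phi)$. For $\lambda\in\mathbb{C}$ let $m_\alpha(\Phi,\lambda)$ be the multiplicity of $\lambda$ as an eigenvalue of $A_\alpha(\Phi)$ ($0$ if $\lambda$ is not an eigenvalue). The gain of a cycle is the product of the gains of its consecutively oriented edges; whether it equals $1$, or equals $-1$, does not depend on the orientation. Then $$m_\alpha(\Phi,\lambda)\le\frac{(\Delta-2)n+2}{\Delta-1},$$ and equality holds if and only if one of the following holds: (i) $G=K_n$, and $A(\Phi)$ has an eigenvalue $\mu$ of multiplicity $n-1$ such that $\lambda=\alpha(n-1)+(1-\alpha)\mu$;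 (ii) $G=C_n$, the gain of this cycle is $1$, and $\lambda=2\alpha+2(1-\alpha)\cos\left(\frac{2\pi j}{n}\right)$ for some $j\in\{1,2,\dots,\lceil n/2\rceil-1\}$; (iii) $G=C_n$, the gain of this cycle is $-1$, and $\lambda=2\alpha+2(1-\alpha)\cos\left(\frac{(2j+1)\pi}{n}\right)$ for some $j\in\{0,1,\dots,\lfloor n/2\rfloor-1\}$; (iv) $n$ is even, $G=K_{n/2,n/2}$, $\Phi$ is switching equivalent to the gain graph $(G,1)$ with all gains equal to $1$ (that is, there is $\zeta:V(G)\to\{z\in\mathbb{C}:|z|=1\}$ with $\varphi(\overrightarrow{uv})=\zeta(u)^{-1}\zeta(v)$ for every oriented edge), and $\lambda=\frac{\alpha n}{2}$. -/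

import Mathlib

/-- A complex unit gain (`𝕋`-gain) on a simple graph `G`: every oriented edge of `G` gets a complex
number of modulus one, and reversing the edge inverts its gain. The pair `(G, φ)` is a
`𝕋`-gain graph. -/
structure UnitGain {V : Type*} (G : SimpleGraph V) where
  gain : G.Dart → Circle
  gain_symm : ∀ d : G.Dart, gain d.symm = (gain d)⁻¹

namespace UnitGain

variable {V : Type*} {G : SimpleGraph V}

/-- The gain `1` on every oriented edge. -/
noncomputable def trivial (G : SimpleGraph V) : UnitGain G where
  gain := fun _ => 1
  gain_symm := fun _ => by simp

/-- Switching equivalence: `φ₁(i → j) = ζ(i)⁻¹ φ₂(i → j) ζ(j)` for some `ζ : V → 𝕋`. -/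
def SwitchingEquiv (φ₁ φ₂ : UnitGain G) : Prop :=
  ∃ ζ : V → Circle, ∀ d : G.Dart, φ₁.gain d = (ζ d.fst)⁻¹ * φ₂.gain d * ζ d.snd

/-- The gain of a walk: the product of the gains of its oriented edges. -/
noncomputable def walkGain (φ : UnitGain G) {u v : V} (p : G.Walk u v) : Circle :=
  (p.darts.map φ.gain).prod

/-- The adjacency matrix `A(Φ)`. -/
noncomputable def adjMatrix (φ : UnitGain G) [DecidableRel G.Adj] : Matrix V V ℂ :=
  Matrix.of fun s t => if h : G.Adj s t then (φ.gain ⟨(s, t), h⟩ : ℂ) else 0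

/-- The matrix `A_α(Φ) = α D + (1 - α) A(Φ)`. -/
noncomputable def alphaMatrix [Fintype V] [DecidableEq V] (φ : UnitGain G) [DecidableRel G.Adj]
    (α : ℝ) : Matrix V V ℂ :=
  (α : ℂ) • G.degMatrix ℂ + ((1 - α : ℝ) : ℂ) • φ.adjMatrix

/-- The multiplicity `m_α(Φ, z)` of `z` as an eigenvalue of `A_α(Φ)`
(`0` if `z` is not an eigenvalue). -/
noncomputable def alphaMult [Fintype V] [DecidableEq V] (φ : UnitGain G) [DecidableRel G.Adj]
    (α : ℝ) (z : ℂ) : ℕ :=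
  (φ.alphaMatrix α).charpoly.rootMultiplicity z

/-- The multiplicity of `z` as an eigenvalue of the adjacency matrix `A(Φ)`. -/
noncomputable def adjMult [Fintype V] [DecidableEq V] (φ : UnitGain G) [DecidableRel G.Adj]
    (z : ℂ) : ℕ :=
  φ.adjMatrix.charpoly.rootMultiplicity z

/-- `(G, φ)` is a gain graph on the cycle `C_n`, `n = |V|`, and the gain of that cycle, traversed
once around, is `g`. Base point and orientation do not matter for the real values `g = ±1`. -/
def IsCycleOfGain [Fintype V] [DecidableEq V] (φ : UnitGain G) (g : ℂ) : Prop :=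
  Nonempty (G ≃g SimpleGraph.cycleGraph (Fintype.card V)) ∧
    ∃ (v : V) (c : G.Walk v v), c.IsHamiltonianCycle ∧ (φ.walkGain c : ℂ) = g

end UnitGain

/-! `A_α(Φ)` is Hermitian, so `m_α(Φ, z) = n - r` with `r` the rank of `A_α(Φ) - z`, and the bound
says `n ≤ r (Δ - 1) + 2`. To bound `r` below, choose rows greedily (`Grown`): the first covers at
most `Δ + 1` vertices, and each later row belongs to a covered vertex with an uncovered neighbour.
Such a row is independent of the earlier ones, which vanish off the covered set, and it covers at
most `Δ - 1` new vertices (`Grown.le_rank`, `card_le_rank_mul`).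

Equality forces every growing process to gain the maximum at each stage (`tightGrowth_of_card_eq`).
Hence `G` is regular, so `A_α` may be replaced by `A(Φ)`, and a covered vertex with two covered
neighbours has no uncovered ones. For `Δ ≥ 3` a triangle then makes `G` complete and `r = 1`;
otherwise the last stage of a process contains a 4-cycle, which makes `G` complete bipartite and `r
= 2`. In the latter case proportional rows give eigenvalue `0` and trivial gains up to switching.

For `Δ = 2` the graph is a cycle. Gauging the gains away turns the eigenvalue equation into `y i + y
(i + 2) = μ y (i + 1)` with `y n = g y 0`, where `g` is the gain of the cycle. A double eigenvalue
means that every solution of the recurrence closes up, so `μ = t + t⁻¹` with `t ^ n = t⁻¹ ^ n = g`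
and `t ^ 2 ≠ 1`; thus `g = ±1` and `μ = 2 cos θ`. -/

open Module SimpleGraph

/-! ### Multiplicity of an eigenvalue as a corank. -/

/-- For a Hermitian matrix, algebraic and geometric multiplicities agree. -/
theorem Matrix.IsHermitian.rootMultiplicity_charpoly_add_rank {V : Type*} [Fintype V]
    [DecidableEq V] {A : Matrix V V ℂ} (hA : A.IsHermitian) (z : ℂ) :
    A.charpoly.rootMultiplicity z + (A - z • (1 : Matrix V V ℂ)).rank = Fintype.card V := by
  classical
  have h1 : A.charpoly.rootMultiplicity z
      = Fintype.card {i // (hA.eigenvalues i : ℂ) - z = 0} := by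
    rw [← Polynomial.count_roots, hA.roots_charpoly_eq_eigenvalues, Multiset.count_map,
      Fintype.card_subtype]
    rw [← Finset.card_val]
    congr 1
    simp only [Finset.filter_val]
    refine Multiset.filter_congr fun i _ => ?_
    rw [sub_eq_zero, eq_comm]
    rfl
  have h2 : (A - z • (1 : Matrix V V ℂ)).rank
      = Fintype.card {i // (hA.eigenvalues i : ℂ) - z ≠ 0} := by
    have hU : A - z • (1 : Matrix V V ℂ) = (hA.eigenvectorUnitary : Matrix V V ℂ) *
        Matrix.diagonal (fun i => (hA.eigenvalues i : ℂ) - z) *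
        (star hA.eigenvectorUnitary : Matrix V V ℂ) := by
      have hd : Matrix.diagonal (fun i => (hA.eigenvalues i : ℂ) - z)
          = Matrix.diagonal (RCLike.ofReal ∘ hA.eigenvalues) - z • (1 : Matrix V V ℂ) := by
        rw [Matrix.smul_one_eq_diagonal, Matrix.diagonal_sub]; rfl
      have hs := hA.spectral_theorem
      rw [Unitary.conjStarAlgAut_apply] at hs
      rw [hd, mul_sub, sub_mul, ← hs]
      simp
    rw [hU, Matrix.rank_mul_eq_left_of_isUnit_det, Matrix.rank_mul_eq_right_of_isUnit_det,
      Matrix.rank_diagonal]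
    · exact (Matrix.isUnit_iff_isUnit_det _).1 (Unitary.isUnit_coe)
    · exact (Matrix.isUnit_iff_isUnit_det _).1
        (Unitary.isUnit_coe (U := star hA.eigenvectorUnitary))
  rw [h1, h2, Fintype.card_subtype_compl]
  exact Nat.add_sub_of_le (Fintype.card_subtype_le _)

/-! ### Growing processes and the rank bound. -/

namespace SimpleGraph

variable {V : Type*} [Fintype V] [DecidableEq V] (G : SimpleGraph V) [DecidableRel G.Adj]

/-- `G.Grown F k`: the vertex set `F` is covered by the closed neighbourhoods of `k` vertices,
chosen one after the other so that each lies in the set covered so far and has a neighbour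
outside of it. -/
inductive Grown : Finset V → ℕ → Prop
  | star (v : V) : Grown (insert v (G.neighborFinset v)) 1
  | step {F : Finset V} {k : ℕ} {u : V} : Grown F k → u ∈ F → ¬ G.neighborFinset u ⊆ F →
      Grown (F ∪ G.neighborFinset u) (k + 1)

variable {G}

theorem Grown.nonempty {F : Finset V} {k : ℕ} (h : G.Grown F k) : F.Nonempty := by
  induction h with
  | star v => exact ⟨v, by simp⟩
  | step _ hu _ _ => exact ⟨_, Finset.mem_union_left _ hu⟩

theorem Grown.exists_adj_mem (hG : ∀ v, (G.neighborFinset v).Nonempty)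
    {F : Finset V} {k : ℕ} (h : G.Grown F k) : ∀ u ∈ F, ∃ w ∈ F, G.Adj u w := by
  induction h with
  | star v =>
    intro u hu
    rcases Finset.mem_insert.1 hu with rfl | hu
    · obtain ⟨w, hw⟩ := hG u
      exact ⟨w, Finset.mem_insert_of_mem hw, by simpa using hw⟩
    · exact ⟨v, Finset.mem_insert_self _ _, ((G.mem_neighborFinset _ _).1 hu).symm⟩
  | @step F k u _ hu _ ih =>
    intro x hx
    rcases Finset.mem_union.1 hx with hx | hx
    · obtain ⟨w, hw, h⟩ := ih x hx
      exact ⟨w, Finset.mem_union_left _ hw, h⟩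
    · exact ⟨u, Finset.mem_union_left _ hu, ((G.mem_neighborFinset _ _).1 hx).symm⟩

/-- The rows chosen in a growing process are linearly independent. -/
theorem Grown.le_rank {K : Type*} [Field K] {M : Matrix V V K}
    (hM : ∀ u v, u ≠ v → (M u v ≠ 0 ↔ G.Adj u v))
    (hG : ∀ v, (G.neighborFinset v).Nonempty) {F : Finset V} {k : ℕ} (h : G.Grown F k) :
    k ≤ M.rank := by
  have hM0 : ∀ u w, w ≠ u → w ∉ G.neighborFinset u → M u w = 0 := fun u w hne hw => by
    by_contra h0
    exact hw ((G.mem_neighborFinset _ _).2 ((hM u w hne.symm).1 h0))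
  -- The induction needs a space of row combinations vanishing off `F`, so that a row reaching
  -- outside `F` cannot belong to it.
  suffices H : ∃ P : Submodule K (V → K), P ≤ Submodule.span K (Set.range M.row) ∧
      k ≤ finrank K P ∧ ∀ x ∈ P, ∀ w ∉ F, x w = 0 by
    obtain ⟨P, hP, hk, -⟩ := H
    rw [Matrix.rank_eq_finrank_span_row]
    exact hk.trans (Submodule.finrank_mono hP)
  induction h with
  | star v =>
    refine ⟨Submodule.span K {M.row v}, Submodule.span_mono (by simp), ?_, ?_⟩
    · obtain ⟨w, hw⟩ := hG v
      rw [G.mem_neighborFinset] at hw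
      rw [finrank_span_singleton]
      intro h0
      exact (hM v w hw.ne).2 hw (congrFun h0 w)
    · intro x hx w hw
      obtain ⟨c, rfl⟩ := Submodule.mem_span_singleton.1 hx
      rw [Finset.mem_insert, not_or] at hw
      simp [hM0 v w hw.1 hw.2]
  | @step F k u _ hu hnot ih =>
    obtain ⟨P, hP, hk, hz⟩ := ih
    obtain ⟨w, hw, hwF⟩ := Finset.not_subset.1 hnot
    rw [G.mem_neighborFinset] at hw
    refine ⟨P ⊔ Submodule.span K {M.row u}, sup_le hP (Submodule.span_mono (by simp)), ?_, ?_⟩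
    · refine lt_of_le_of_lt hk (Submodule.finrank_lt_finrank_of_lt ?_)
      refine lt_of_le_of_ne le_sup_left fun heq => ?_
      have hmem : M.row u ∈ P := by
        rw [heq]
        exact Submodule.mem_sup_right (Submodule.mem_span_singleton_self _)
      exact (hM u w hw.ne).2 hw (hz _ hmem w hwF)
    · intro x hx w hw
      obtain ⟨y, hy, x', hx', rfl⟩ := Submodule.mem_sup.1 hx
      obtain ⟨c, rfl⟩ := Submodule.mem_span_singleton.1 hx'
      rw [Finset.mem_union, not_or] at hw
      have : w ≠ u := fun h => hw.1 (h ▸ hu)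
      simp [hM0 u w this hw.2, hz y hy w hw.1]

/-- `u` already has a covered neighbour, so at most `Δ - 1` of its neighbours are new. -/
theorem Grown.card_step_le (hG : ∀ v, (G.neighborFinset v).Nonempty) {F : Finset V} {k : ℕ}
    (h : G.Grown F k) {u : V} (hu : u ∈ F) :
    (F ∪ G.neighborFinset u).card ≤ F.card + (G.maxDegree - 1) := by
  obtain ⟨w, hw, huw⟩ := h.exists_adj_mem hG u hu
  rw [Finset.card_union]
  have h1 : 1 ≤ (F ∩ G.neighborFinset u).card :=
    Finset.card_pos.2 ⟨w, Finset.mem_inter.2 ⟨hw, (G.mem_neighborFinset _ _).2 huw⟩⟩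
  have h2 : (G.neighborFinset u).card ≤ G.maxDegree := G.degree_le_maxDegree u
  omega

omit [DecidableEq V] [DecidableRel G.Adj] in
theorem Connected.exists_adj_notMem (hc : G.Connected) {F : Finset V} (hne : F.Nonempty)
    (hF : F ≠ Finset.univ) : ∃ u ∈ F, ∃ v ∉ F, G.Adj u v := by
  obtain ⟨a, ha⟩ := hne
  obtain ⟨b, hb⟩ : ∃ b, b ∉ F := by
    by_contra hcon
    push Not at hcon
    exact hF (Finset.eq_univ_of_forall hcon)
  obtain ⟨p⟩ := hc.preconnected a b
  obtain ⟨d, -, h1, h2⟩ := p.exists_boundary_dart (F : Set V) ha hb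
  exact ⟨d.fst, h1, d.snd, h2, d.adj⟩

omit [DecidableEq V] in
theorem Connected.eq_univ_of_neighborFinset_subset (hc : G.Connected) {F : Finset V}
    (hne : F.Nonempty) (hF : ∀ u ∈ F, G.neighborFinset u ⊆ F) : F = Finset.univ := by
  by_contra hcon
  obtain ⟨u, hu, v, hv, huv⟩ := hc.exists_adj_notMem hne hcon
  exact hv (hF u hu ((G.mem_neighborFinset _ _).2 huv))

/-- While `F ≠ V`, connectedness supplies an edge leaving `F`, hence a further step. Starting from
an arbitrary stage is what the equality case needs. -/
theorem Grown.exists_extend (hG : ∀ v, (G.neighborFinset v).Nonempty) (hc : G.Connected)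
    {F : Finset V} {k : ℕ} (h : G.Grown F k) :
    ∃ j, G.Grown Finset.univ (k + j) ∧ Fintype.card V ≤ F.card + j * (G.maxDegree - 1) := by
  induction hd : Fintype.card V - F.card using Nat.strong_induction_on generalizing F k with
  | _ d ih =>
  by_cases hF : F = Finset.univ
  · subst hF
    exact ⟨0, h, by simp⟩
  · obtain ⟨u, hu, v, hv, huv⟩ := hc.exists_adj_notMem h.nonempty hF
    have hv' : v ∈ G.neighborFinset u := (G.mem_neighborFinset _ _).2 huv
    have hnot : ¬ G.neighborFinset u ⊆ F := fun hs => hv (hs hv')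
    have hlt : F.card < (F ∪ G.neighborFinset u).card := by
      refine Finset.card_lt_card ⟨Finset.subset_union_left, fun hs => hv (hs ?_)⟩
      exact Finset.mem_union_right _ hv'
    have hle : (F ∪ G.neighborFinset u).card ≤ Fintype.card V := Finset.card_le_univ _
    obtain ⟨j, hj, hjc⟩ := ih _ (by omega) (Grown.step h hu hnot) rfl
    refine ⟨j + 1, by convert hj using 1; ring, ?_⟩
    have := h.card_step_le hG hu
    rw [add_mul, one_mul]
    omega

theorem Grown.star_card (v : V) :
    (insert v (G.neighborFinset v)).card = G.degree v + 1 := by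
  rw [Finset.card_insert_of_notMem (by simp), card_neighborFinset_eq_degree]

/-- Every growing process in `G` covers as many vertices as the maximum degree permits. -/
def TightGrowth (G : SimpleGraph V) [DecidableRel G.Adj] : Prop :=
  ∀ F k, G.Grown F k → F.card = k * (G.maxDegree - 1) + 2

section Rank

variable {K : Type*} [Field K] {M : Matrix V V K}

/-- The rank of a matrix whose off-diagonal support is a connected graph on `n` vertices with
maximum degree `Δ` is at least `(n - 2) / (Δ - 1)`. -/
theorem card_le_rank_mul (hM : ∀ u v, u ≠ v → (M u v ≠ 0 ↔ G.Adj u v))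
    (hG : ∀ v, (G.neighborFinset v).Nonempty) (hc : G.Connected) (hΔ : 1 ≤ G.maxDegree) :
    Fintype.card V ≤ M.rank * (G.maxDegree - 1) + 2 := by
  obtain ⟨v⟩ := hc.nonempty
  obtain ⟨j, hj, hjc⟩ := (Grown.star (G := G) v).exists_extend hG hc
  have h1 := hj.le_rank hM hG
  have h2 := G.degree_le_maxDegree v
  rw [Grown.star_card] at hjc
  have h3 : (1 + j) * (G.maxDegree - 1) ≤ M.rank * (G.maxDegree - 1) :=
    Nat.mul_le_mul_right _ h1
  rw [add_mul, one_mul] at h3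
  omega

/-- If the rank bound is attained, every growing process covers as many vertices as possible. -/
theorem tightGrowth_of_card_eq (hM : ∀ u v, u ≠ v → (M u v ≠ 0 ↔ G.Adj u v))
    (hG : ∀ v, (G.neighborFinset v).Nonempty) (hc : G.Connected) (hΔ : 1 ≤ G.maxDegree)
    (heq : Fintype.card V = M.rank * (G.maxDegree - 1) + 2) : G.TightGrowth := by
  intro F k h
  apply le_antisymm
  · clear heq
    induction h with
    | star v =>
      rw [Grown.star_card]
      have h2 := G.degree_le_maxDegree v
      omega
    | step h hu hnot ih =>
      have := h.card_step_le hG hu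
      rw [add_mul, one_mul]
      omega
  -- A shortfall at one stage could never be made up: later steps gain at most `Δ - 1` each, and
  -- their number is limited by the rank.
  · obtain ⟨j, hj, hjc⟩ := h.exists_extend hG hc
    have h3 : (k + j) * (G.maxDegree - 1) ≤ M.rank * (G.maxDegree - 1) :=
      Nat.mul_le_mul_right _ (hj.le_rank hM hG)
    rw [add_mul] at h3
    omega

end Rank

/-! ### Classification of graphs with tight growth. -/

theorem TightGrowth.degree_eq (H : G.TightGrowth) (hΔ : 1 ≤ G.maxDegree) (v : V) :
    G.degree v = G.maxDegree := by
  have := H _ _ (Grown.star v)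
  rw [Grown.star_card] at this
  omega

theorem TightGrowth.card_sdiff (H : G.TightGrowth) {F : Finset V} {k : ℕ} (h : G.Grown F k)
    {u : V} (hu : u ∈ F) (hnot : ¬ G.neighborFinset u ⊆ F) :
    (G.neighborFinset u \ F).card = G.maxDegree - 1 := by
  have h1 := H _ _ h
  have h2 := H _ _ (Grown.step h hu hnot)
  rw [Finset.union_comm, ← Finset.sdiff_union_self_eq_union,
    Finset.card_union_of_disjoint Finset.sdiff_disjoint, h1, add_mul, one_mul] at h2
  omega

/-- A covered vertex with two covered neighbours has all its neighbours covered. -/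
theorem TightGrowth.neighborFinset_subset (H : G.TightGrowth) {F : Finset V} {k : ℕ}
    (h : G.Grown F k) (hΔ : 1 ≤ G.maxDegree) {u x y : V} (hu : u ∈ F) (hx : x ∈ F) (hy : y ∈ F)
    (hxy : x ≠ y) (hux : G.Adj u x) (huy : G.Adj u y) : G.neighborFinset u ⊆ F := by
  by_contra hnot
  have h1 := H.card_sdiff h hu hnot
  have h2 : (G.neighborFinset u).card = G.maxDegree := H.degree_eq hΔ u
  have h3 : 1 < (G.neighborFinset u ∩ F).card :=
    Finset.one_lt_card.2 ⟨x, by simp [hx, hux], y, by simp [hy, huy], hxy⟩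
  have h4 := Finset.card_sdiff_add_card_inter (G.neighborFinset u) F
  omega

/-- Start from the star of `a`. Since `b` has the covered neighbours `a` and `c`, all of `N(b)` is
covered, and regularity makes the closed neighbourhoods of `a` and `b` equal. Every other covered
vertex is then adjacent to both, so the star is closed under adjacency and is all of `V`. -/
theorem TightGrowth.eq_top_of_triangle (H : G.TightGrowth) (hΔ : 1 ≤ G.maxDegree)
    (hc : G.Connected) {a b c : V} (hab : G.Adj a b) (hac : G.Adj a c) (hbc : G.Adj b c) :
    G = ⊤ := by
  have hF := Grown.star (G := G) a
  set F := insert a (G.neighborFinset a) with hFdef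
  have haF : a ∈ F := Finset.mem_insert_self _ _
  have hmem : ∀ w, G.Adj a w → w ∈ F := fun w hw => by simp [hFdef, hw]
  have heq : ∀ w ∈ F, G.neighborFinset w ⊆ F → insert w (G.neighborFinset w) = F := by
    intro w hw hs
    refine Finset.eq_of_subset_of_card_le (Finset.insert_subset hw hs) ?_
    rw [hFdef, Grown.star_card, Grown.star_card, H.degree_eq hΔ, H.degree_eq hΔ]
  have hb := heq b (hmem b hab)
    (H.neighborFinset_subset hF hΔ (hmem b hab) haF (hmem c hac) hac.ne hab.symm hbc)
  have hall : ∀ w ∈ F, G.neighborFinset w ⊆ F := by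
    intro w hw
    by_cases hwb : w = b
    · subst hwb
      exact H.neighborFinset_subset hF hΔ hw haF (hmem c hac) hac.ne hab.symm hbc
    by_cases hwa : w = a
    · subst hwa
      exact Finset.subset_insert _ _
    have h1 : G.Adj w b := by
      have : w ∈ insert b (G.neighborFinset b) := hb ▸ hw
      simp only [Finset.mem_insert, hwb, false_or, mem_neighborFinset] at this
      exact this.symm
    have h2 : G.Adj w a := by
      simp only [hFdef, Finset.mem_insert, hwa, false_or, mem_neighborFinset] at hw
      exact hw.symm
    exact H.neighborFinset_subset hF hΔ hw haF (hmem b hab) hab.ne h2 h1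
  have huniv := hc.eq_univ_of_neighborFinset_subset ⟨a, haF⟩ hall
  ext x y
  rw [top_adj]
  refine ⟨fun h => h.ne, fun hne => ?_⟩
  have hx : x ∈ F := huniv ▸ Finset.mem_univ x
  have hy : y ∈ insert x (G.neighborFinset x) := by
    rw [heq x hx (hall x hx), huniv]
    exact Finset.mem_univ y
  simpa [hne.symm] using hy

/-- Adjacent vertices `a` and `b` witness that `G` is complete bipartite with parts
`N(a)` and `N(b)`. -/
structure IsBipartiteWitness (G : SimpleGraph V) [DecidableRel G.Adj] (a b : V) : Prop where
  adj : G.Adj a b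
  left : ∀ x, G.Adj a x → G.neighborFinset x = G.neighborFinset b
  right : ∀ x, G.Adj b x → G.neighborFinset x = G.neighborFinset a
  cover : ∀ x, G.Adj a x ∨ G.Adj b x
  disj : ∀ x, G.Adj a x → ¬ G.Adj b x

/-- The rows of `a` and `b` cover `N(a) ∪ N(b)`. As `c` has the covered neighbours `b` and `d`, its
neighbours are covered; they avoid `N(b)` for lack of triangles, so `N(c) = N(a)` by regularity.
Each `x ∈ N(a)` then has the covered neighbours `a` and `c`, whence `N(x) = N(b)`; the same argument
with `b` and `d` treats `N(b)`. -/
theorem TightGrowth.isBipartiteWitness_of_square (H : G.TightGrowth) (hΔ : 1 ≤ G.maxDegree)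
    (hc : G.Connected) (htri : ∀ a b c, G.Adj a b → G.Adj a c → ¬ G.Adj b c)
    {a b c d : V} (hab : G.Adj a b) (hbc : G.Adj b c) (hcd : G.Adj c d) (hda : G.Adj d a)
    (hac : a ≠ c) (hbd : b ≠ d) : G.IsBipartiteWitness a b := by
  have hnac : ¬ G.Adj a c := htri b a c hab.symm hbc
  have hF : G.Grown (insert a (G.neighborFinset a) ∪ G.neighborFinset b) 2 := by
    refine Grown.step (Grown.star a) (by simp [hab]) (Finset.not_subset.2 ⟨c, by simp [hbc], ?_⟩)
    simp [hac.symm, hnac]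
  set F := insert a (G.neighborFinset a) ∪ G.neighborFinset b with hFdef
  have hmemF : ∀ x, x ∈ F ↔ G.Adj a x ∨ G.Adj b x := by
    intro x
    simp only [hFdef, Finset.mem_union, Finset.mem_insert, mem_neighborFinset]
    constructor
    · rintro ((rfl | h) | h)
      · exact Or.inr hab.symm
      · exact Or.inl h
      · exact Or.inr h
    · rintro (h | h)
      · exact Or.inl (Or.inr h)
      · exact Or.inr h
  have key : ∀ x y z : V, G.Adj x y → G.Adj x z → y ≠ z → x ∈ F → y ∈ F → z ∈ F →
      ∀ w, G.Adj x w → G.Adj a w ∨ G.Adj b w := fun x y z hy hz hne hxF hyF hzF w hw =>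
    (hmemF w).1 (H.neighborFinset_subset hF hΔ hxF hyF hzF hne hy hz
      ((G.mem_neighborFinset _ _).2 hw))
  have haF : a ∈ F := (hmemF a).2 (Or.inr hab.symm)
  have hbF : b ∈ F := (hmemF b).2 (Or.inl hab)
  have hcF : c ∈ F := (hmemF c).2 (Or.inr hbc)
  have hdF : d ∈ F := (hmemF d).2 (Or.inl hda.symm)
  have heq : ∀ x y, (∀ w, G.Adj x w → G.Adj y w) → G.neighborFinset x = G.neighborFinset y := by
    intro x y h
    refine Finset.eq_of_subset_of_card_le (fun w hw => ?_) ?_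
    · rw [mem_neighborFinset] at hw ⊢
      exact h w hw
    · rw [card_neighborFinset_eq_degree, card_neighborFinset_eq_degree, H.degree_eq hΔ,
        H.degree_eq hΔ]
  have hN : ∀ {x y}, G.neighborFinset x = G.neighborFinset y → ∀ w, G.Adj x w ↔ G.Adj y w := by
    intro x y h w
    rw [← mem_neighborFinset, h, mem_neighborFinset]
  have hNc : G.neighborFinset c = G.neighborFinset a := by
    refine heq c a fun w hw => ?_
    rcases key c b d hbc.symm hcd hbd hcF hbF hdF w hw with h | h
    · exact h
    · exact absurd hw (htri b c w hbc h)
  have hleft : ∀ x, G.Adj a x → G.neighborFinset x = G.neighborFinset b := by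
    intro x hx
    have hcx : G.Adj c x := (hN hNc x).2 hx
    refine heq x b fun w hw => ?_
    rcases key x a c hx.symm hcx.symm hac ((hmemF x).2 (Or.inl hx)) haF hcF w hw with h | h
    · exact absurd hw (htri a x w hx h)
    · exact h
  have hright : ∀ x, G.Adj b x → G.neighborFinset x = G.neighborFinset a := by
    intro x hx
    have hdx : G.Adj d x := (hN (hleft d hda.symm) x).2 hx
    refine heq x a fun w hw => ?_
    rcases key x b d hx.symm hdx.symm hbd ((hmemF x).2 (Or.inr hx)) hbF hdF w hw with h | h
    · exact h
    · exact absurd hw (htri b x w hx h)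
  refine ⟨hab, hleft, hright, fun x => ?_, fun x hax hbx => htri a b x hab hax hbx⟩
  have huniv := hc.eq_univ_of_neighborFinset_subset ⟨a, haF⟩ (F := F) (by
    intro u hu w hw
    rw [mem_neighborFinset] at hw
    rcases (hmemF u).1 hu with h | h
    · exact (hmemF w).2 (Or.inr ((hN (hleft u h) w).1 hw))
    · exact (hmemF w).2 (Or.inl ((hN (hright u h) w).1 hw)))
  exact (hmemF x).1 (huniv ▸ Finset.mem_univ x)

/-- A connected graph of maximum degree at least three with tight growth is complete or
complete bipartite. -/
theorem TightGrowth.eq_top_or_isBipartiteWitness (H : G.TightGrowth) (hΔ : 3 ≤ G.maxDegree)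
    (hc : G.Connected) : G = ⊤ ∨ ∃ a b, G.IsBipartiteWitness a b := by
  have hΔ1 : 1 ≤ G.maxDegree := by omega
  by_cases htri : ∃ a b c, G.Adj a b ∧ G.Adj a c ∧ G.Adj b c
  · obtain ⟨a, b, c, hab, hac, hbc⟩ := htri
    exact Or.inl (H.eq_top_of_triangle hΔ1 hc hab hac hbc)
  right
  have htri' : ∀ a b c, G.Adj a b → G.Adj a c → ¬ G.Adj b c :=
    fun a b c hab hac hbc => htri ⟨a, b, c, hab, hac, hbc⟩
  have hdeg : ∀ v, (G.neighborFinset v).card = G.maxDegree := H.degree_eq hΔ1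
  have hG : ∀ v, (G.neighborFinset v).Nonempty := fun v =>
    Finset.card_pos.1 (by rw [hdeg v]; omega)
  obtain ⟨v₀⟩ := hc.nonempty
  -- Run a process until it covers `V` and inspect its last step.
  obtain ⟨j, hj, -⟩ := (Grown.star (G := G) v₀).exists_extend hG hc
  generalize hU : (Finset.univ : Finset V) = U at hj
  generalize 1 + j = m at hj
  cases hj with
  | star v =>
    -- If one star covers `V`, a second neighbour of any `w ∈ N(v)` lies in `N(v)` too and closes a
    -- triangle.
    exfalso
    obtain ⟨w, hw⟩ := hG v
    obtain ⟨x, hx, hxv⟩ := Finset.exists_mem_ne (s := G.neighborFinset w)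
      (by rw [hdeg w]; omega) v
    have hxU : x ∈ insert v (G.neighborFinset v) := hU ▸ Finset.mem_univ x
    simp only [Finset.mem_insert, mem_neighborFinset, hxv, false_or] at hw hx hxU
    exact htri' v w x hw hxU hx
  | @step F k u hF hu hnot =>
    have hL := H.card_sdiff hF hu hnot
    set L := G.neighborFinset u \ F with hLdef
    have hmemL : ∀ x, x ∈ L ↔ x ∉ F := by
      intro x
      have hx : x ∈ F ∪ G.neighborFinset u := hU ▸ Finset.mem_univ x
      rw [Finset.mem_union] at hx
      rw [hLdef, Finset.mem_sdiff]
      tauto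
    have hLu : ∀ x ∈ L, G.Adj u x := fun x hx => by
      simpa using (Finset.mem_sdiff.1 hx).1
    obtain ⟨w, hw, w', hw', hne⟩ := Finset.one_lt_card.1 (show 1 < L.card by omega)
    -- `insert u (L.erase w)` has at most `Δ - 1` elements, too few to contain `N(w)`.
    obtain ⟨u', hu', hu'n⟩ : ∃ u' ∈ G.neighborFinset w, u' ∉ insert u (L.erase w) := by
      by_contra hcon
      push Not at hcon
      have h1 := Finset.card_le_card (s := G.neighborFinset w) hcon
      have h2 := Finset.card_insert_le u (L.erase w)
      rw [Finset.card_erase_of_mem hw] at h2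
      rw [hdeg w] at h1
      omega
    rw [mem_neighborFinset] at hu'
    simp only [Finset.mem_insert, Finset.mem_erase, not_or, not_and] at hu'n
    have hu'F : u' ∈ F := by
      by_contra h
      exact hu'n.2 hu'.ne' ((hmemL u').2 h)
    -- By tightness `u'` also has `Δ - 1` uncovered neighbours, which is all of `L`; so `u, w, u',
    -- w'` is a 4-cycle.
    have hsub : G.neighborFinset u' \ F = L := by
      refine Finset.eq_of_subset_of_card_le
        (fun x hx => (hmemL x).2 (Finset.mem_sdiff.1 hx).2) ?_
      rw [hL, H.card_sdiff hF hu'F (Finset.not_subset.2 ⟨w, ?_, (hmemL w).1 hw⟩)]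
      simpa using hu'.symm
    have hu'w' : G.Adj u' w' := by
      rw [← hsub] at hw'
      simpa using (Finset.mem_sdiff.1 hw').1
    exact ⟨u, w, H.isBipartiteWitness_of_square hΔ1 hc htri' (hLu w hw) hu' hu'w'
      (hLu w' hw').symm (Ne.symm hu'n.1) hne⟩

end SimpleGraph

/-! ### Matrices of a gain graph and reduction to `A(Φ)` for regular graphs. -/

namespace UnitGain

variable {V : Type*} {G : SimpleGraph V} [DecidableRel G.Adj] (φ : UnitGain G)

theorem adjMatrix_of_adj {s t : V} (h : G.Adj s t) :
    φ.adjMatrix s t = (φ.gain ⟨(s, t), h⟩ : ℂ) := by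
  simp [adjMatrix, h]

theorem adjMatrix_of_not_adj {s t : V} (h : ¬ G.Adj s t) : φ.adjMatrix s t = 0 := by
  simp [adjMatrix, h]

theorem adjMatrix_ne_zero_iff {s t : V} : φ.adjMatrix s t ≠ 0 ↔ G.Adj s t := by
  by_cases h : G.Adj s t
  · simp [φ.adjMatrix_of_adj h, h]
  · simp [φ.adjMatrix_of_not_adj h, h]

omit [DecidableRel G.Adj] in
theorem gain_swap {s t : V} (h : G.Adj s t) :
    φ.gain ⟨(t, s), h.symm⟩ = (φ.gain ⟨(s, t), h⟩)⁻¹ :=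
  φ.gain_symm ⟨(s, t), h⟩

theorem adjMatrix_swap (s t : V) : φ.adjMatrix t s = (φ.adjMatrix s t)⁻¹ := by
  by_cases h : G.Adj s t
  · rw [φ.adjMatrix_of_adj h, φ.adjMatrix_of_adj h.symm, φ.gain_swap h, Circle.coe_inv]
  · have h' : ¬ G.Adj t s := fun h' => h h'.symm
    simp [φ.adjMatrix_of_not_adj h, φ.adjMatrix_of_not_adj h']

theorem adjMatrix_isHermitian : φ.adjMatrix.IsHermitian := by
  ext s t
  rw [Matrix.conjTranspose_apply, φ.adjMatrix_swap s t]
  by_cases h : G.Adj s t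
  · rw [φ.adjMatrix_of_adj h, ← Circle.coe_inv, Circle.coe_inv_eq_conj]
    simp
  · simp [φ.adjMatrix_of_not_adj h]

theorem walkGain_eq_prod {u v : V} (p : G.Walk u v) : (φ.walkGain p : ℂ) =
    ∏ j ∈ Finset.range p.length, φ.adjMatrix (p.getVert j) (p.getVert (j + 1)) := by
  induction p with
  | nil => simp [walkGain]
  | @cons a b c h p ih =>
    have : φ.walkGain (Walk.cons h p) = φ.gain ⟨(a, b), h⟩ * φ.walkGain p := by
      simp [walkGain]
    rw [this, Circle.coe_mul, ih, Walk.length_cons, Finset.prod_range_succ', mul_comm]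
    simp [φ.adjMatrix_of_adj h]

variable [Fintype V] [DecidableEq V]

theorem alphaMatrix_isHermitian (α : ℝ) : (φ.alphaMatrix α).IsHermitian := by
  refine Matrix.IsHermitian.add ?_ ?_
  · rw [SimpleGraph.degMatrix, Matrix.IsHermitian, Matrix.conjTranspose_smul,
      Matrix.diagonal_conjTranspose]
    congr 1
    · simp
    · congr 1
      ext i
      simp
  · rw [Matrix.IsHermitian, Matrix.conjTranspose_smul, φ.adjMatrix_isHermitian.eq]
    congr 1
    simp

theorem alphaMult_add_rank (α : ℝ) (z : ℂ) :
    φ.alphaMult α z + (φ.alphaMatrix α - z • (1 : Matrix V V ℂ)).rank = Fintype.card V :=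
  (φ.alphaMatrix_isHermitian α).rootMultiplicity_charpoly_add_rank z

theorem adjMult_add_rank (z : ℂ) :
    φ.adjMult z + (φ.adjMatrix - z • (1 : Matrix V V ℂ)).rank = Fintype.card V :=
  φ.adjMatrix_isHermitian.rootMultiplicity_charpoly_add_rank z

theorem adjMult_eq_finrank_ker (z : ℂ) :
    φ.adjMult z = finrank ℂ (LinearMap.ker (φ.adjMatrix - z • (1 : Matrix V V ℂ)).mulVecLin) := by
  have h1 := φ.adjMult_add_rank z
  have h2 := LinearMap.finrank_range_add_finrank_ker
    (φ.adjMatrix - z • (1 : Matrix V V ℂ)).mulVecLin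
  rw [← Matrix.rank, finrank_fintype_fun_eq_card] at h2
  omega

theorem mem_ker_sub_smul_one_iff {A : Matrix V V ℂ} {μ : ℂ} {x : V → ℂ} :
    x ∈ LinearMap.ker (A - μ • (1 : Matrix V V ℂ)).mulVecLin ↔
      ∀ u, ∑ w, A u w * x w = μ * x u := by
  rw [LinearMap.mem_ker, Matrix.mulVecLin_apply, Matrix.sub_mulVec, Matrix.smul_mulVec,
    Matrix.one_mulVec, sub_eq_zero, funext_iff]
  rfl

theorem alphaMatrix_sub_apply_ne_zero_iff {α : ℝ} (hα : α < 1) (z : ℂ) (u v : V) (huv : u ≠ v) :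
    (φ.alphaMatrix α - z • (1 : Matrix V V ℂ)) u v ≠ 0 ↔ G.Adj u v := by
  have h1 : ((1 - α : ℝ) : ℂ) ≠ 0 := by
    exact_mod_cast (sub_pos.2 hα).ne'
  rw [← φ.adjMatrix_ne_zero_iff]
  simp only [alphaMatrix, SimpleGraph.degMatrix, Matrix.sub_apply, Matrix.add_apply,
    Matrix.smul_apply, Matrix.diagonal_apply_ne _ huv, Matrix.one_apply_ne huv, smul_eq_mul,
    mul_zero, zero_add, sub_zero]
  rw [mul_ne_zero_iff, and_iff_right h1]

theorem alphaMatrix_sub_eq_of_regular {d : ℕ} (hd : ∀ v, G.degree v = d) {α : ℝ} (hα : α < 1)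
    (z : ℂ) : φ.alphaMatrix α - z • (1 : Matrix V V ℂ) = ((1 - α : ℝ) : ℂ) •
      (φ.adjMatrix - ((z - α * d) / ((1 - α : ℝ) : ℂ)) • (1 : Matrix V V ℂ)) := by
  have h1 : ((1 - α : ℝ) : ℂ) ≠ 0 := by
    exact_mod_cast (sub_pos.2 hα).ne'
  have h2 : G.degMatrix ℂ = (d : ℂ) • (1 : Matrix V V ℂ) := by
    rw [SimpleGraph.degMatrix, Matrix.smul_one_eq_diagonal]
    congr 1
    ext v
    rw [hd v]
  rw [alphaMatrix, h2, smul_sub, smul_smul, smul_smul, mul_div_cancel₀ _ h1, sub_smul]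
  abel

/-- For a regular graph, the eigenvalues of `A_α` are those of the adjacency matrix after an
affine change of variable. -/
theorem alphaMult_eq_adjMult_of_regular {d : ℕ} (hd : ∀ v, G.degree v = d) {α : ℝ} (hα : α < 1)
    (z : ℂ) : φ.alphaMult α z = φ.adjMult ((z - α * d) / ((1 - α : ℝ) : ℂ)) := by
  have h1 : ((1 - α : ℝ) : ℂ) ≠ 0 := by
    exact_mod_cast (sub_pos.2 hα).ne'
  have h2 := φ.alphaMult_add_rank α z
  have h3 := φ.adjMult_add_rank ((z - α * d) / ((1 - α : ℝ) : ℂ))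
  rw [φ.alphaMatrix_sub_eq_of_regular hd hα,
    Matrix.rank_smul_of_mem_nonZeroDivisors _ (mem_nonZeroDivisors_of_ne_zero h1)] at h2
  omega

end UnitGain

/-! ### Connected 2-regular graphs are cycles. -/

namespace SimpleGraph

variable {V : Type*} [Fintype V] [DecidableEq V] {G : SimpleGraph V} [DecidableRel G.Adj]

theorem exists_isHamiltonianCycle_of_degree_eq_two (hc : G.Connected)
    (h2 : ∀ v, G.degree v = 2) : ∃ (v : V) (c : G.Walk v v), c.IsHamiltonianCycle := by
  obtain ⟨v⟩ := hc.nonempty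
  have hcyc : G.IsCycles := by
    intro u _
    rw [Set.ncard_eq_toFinset_card', ← neighborFinset_def]
    exact h2 u
  have hne : (G.neighborSet v).Nonempty := by
    have : 0 < (G.neighborFinset v).card := by
      rw [card_neighborFinset_eq_degree, h2]; omega
    obtain ⟨w, hw⟩ := Finset.card_pos.1 this
    exact ⟨w, by simpa using hw⟩
  obtain ⟨p, hp, hv⟩ := hcyc.exists_cycle_toSubgraph_verts_eq_connectedComponentSupp
    (c := G.connectedComponentMk v) (v := v) rfl hne
  refine ⟨v, p, hp, hp.isPath_tail.isHamiltonian_of_mem fun w => ?_⟩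
  have hw : w ∈ p.toSubgraph.verts := by
    rw [hv]
    exact ConnectedComponent.sound (hc.preconnected w v)
  rw [Walk.mem_verts_toSubgraph, ← Walk.cons_support_tail hp.not_nil, List.mem_cons] at hw
  rcases hw with rfl | hw
  · exact Walk.end_mem_support _
  · exact hw

omit [DecidableEq V] in
theorem degree_eq_of_iso {W : Type*} [Fintype W] {H : SimpleGraph W} [DecidableRel H.Adj]
    (e : G ≃g H) (v : V) : G.degree v = H.degree (e v) := by
  rw [← card_neighborSet_eq_degree, ← card_neighborSet_eq_degree]
  exact Fintype.card_congr (e.mapNeighborSet v)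

theorem cycleGraph_degree_of_three_le {n : ℕ} (hn : 3 ≤ n) (v : Fin n) :
    (cycleGraph n).degree v = 2 := by
  obtain ⟨m, rfl⟩ := Nat.exists_eq_add_of_le' hn
  exact cycleGraph_degree_three_le

/-- The Hamiltonian cycle gives a bijective homomorphism from `C_n`; both graphs being 2-regular, no
edge of `G` is left over. -/
theorem nonempty_iso_cycleGraph (h2 : ∀ v, G.degree v = 2) {v : V} {c : G.Walk v v}
    (hc : c.IsHamiltonianCycle) : Nonempty (G ≃g cycleGraph (Fintype.card V)) := by
  have h3 := hc.isCycle.three_le_length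
  rw [hc.length_eq] at h3
  obtain ⟨f⟩ := (cycleGraph_isContained_iff (G := G) h3).2 ⟨v, c, hc.isCycle, hc.length_eq⟩
  have hinj : Function.Injective f := f.injective
  have hbij : Function.Bijective f :=
    (Fintype.bijective_iff_injective_and_card _).2 ⟨hinj, by simp⟩
  refine ⟨SimpleGraph.Iso.symm ⟨Equiv.ofBijective f hbij, ?_⟩⟩
  intro a b
  simp only [Equiv.ofBijective_apply]
  refine ⟨fun hab => ?_, fun hab => f.toHom.map_adj hab⟩
  have himg : ((cycleGraph (Fintype.card V)).neighborFinset a).image f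
      = G.neighborFinset (f a) := by
    refine Finset.eq_of_subset_of_card_le ?_ ?_
    · intro x hx
      obtain ⟨y, hy, rfl⟩ := Finset.mem_image.1 hx
      rw [mem_neighborFinset] at hy ⊢
      exact f.toHom.map_adj hy
    · rw [Finset.card_image_of_injective _ hinj, card_neighborFinset_eq_degree,
        card_neighborFinset_eq_degree, h2,
        cycleGraph_degree_of_three_le h3]
  have hb : f b ∈ G.neighborFinset (f a) := (G.mem_neighborFinset _ _).2 hab
  rw [← himg, Finset.mem_image] at hb
  obtain ⟨y, hy, hyb⟩ := hb
  rw [← hinj hyb]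
  simpa using hy

end SimpleGraph

/-! ### Double eigenvalues of a gain cycle. -/

namespace UnitGain

section PrefixGain

variable {V : Type*} {G : SimpleGraph V} [DecidableRel G.Adj] (φ : UnitGain G)

/-- The gain of the initial segment of length `i` of a walk. -/
noncomputable def prefixGain {u v : V} (c : G.Walk u v) (i : ℕ) : ℂ :=
  ∏ j ∈ Finset.range i, φ.adjMatrix (c.getVert j) (c.getVert (j + 1))

variable {φ}

theorem prefixGain_zero {u v : V} (c : G.Walk u v) : φ.prefixGain c 0 = 1 := by
  simp [prefixGain]

theorem prefixGain_succ {u v : V} (c : G.Walk u v) (i : ℕ) : φ.prefixGain c (i + 1) =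
    φ.prefixGain c i * φ.adjMatrix (c.getVert i) (c.getVert (i + 1)) :=
  Finset.prod_range_succ _ _

theorem prefixGain_length {u v : V} (c : G.Walk u v) :
    φ.prefixGain c c.length = φ.walkGain c :=
  (φ.walkGain_eq_prod c).symm

theorem prefixGain_ne_zero {u v : V} (c : G.Walk u v) {i : ℕ} (hi : i ≤ c.length) :
    φ.prefixGain c i ≠ 0 := by
  refine Finset.prod_ne_zero_iff.2 fun j hj => ?_
  rw [Finset.mem_range] at hj
  exact φ.adjMatrix_ne_zero_iff.2 (c.adj_getVert_succ (by omega))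

theorem prefixGain_succ_mul_adjMatrix {u v : V} (c : G.Walk u v) {i : ℕ} (hi : i < c.length) :
    φ.prefixGain c (i + 1) * φ.adjMatrix (c.getVert (i + 1)) (c.getVert i)
      = φ.prefixGain c i := by
  rw [prefixGain_succ, φ.adjMatrix_swap (c.getVert i), mul_assoc, mul_inv_cancel₀, mul_one]
  exact φ.adjMatrix_ne_zero_iff.2 (c.adj_getVert_succ hi)

end PrefixGain

variable {V : Type*} [Fintype V] [DecidableEq V] {G : SimpleGraph V} [DecidableRel G.Adj]
  (φ : UnitGain G)

theorem sum_adjMatrix_of_degree_eq_two (h2 : ∀ v, G.degree v = 2) {u p q : V} (hp : G.Adj u p)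
    (hq : G.Adj u q) (hpq : p ≠ q) (x : V → ℂ) :
    ∑ w, φ.adjMatrix u w * x w = φ.adjMatrix u p * x p + φ.adjMatrix u q * x q := by
  have hN : G.neighborFinset u = {p, q} := by
    symm
    refine Finset.eq_of_subset_of_card_le ?_ ?_
    · intro w hw
      simp only [Finset.mem_insert, Finset.mem_singleton] at hw
      rcases hw with rfl | rfl <;> simpa
    · rw [Finset.card_pair hpq, card_neighborFinset_eq_degree, h2]
  rw [← Finset.sum_pair hpq (f := fun w => φ.adjMatrix u w * x w), ← hN]
  symm
  refine Finset.sum_subset (Finset.subset_univ _) fun w _ hw => ?_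
  rw [mem_neighborFinset] at hw
  rw [φ.adjMatrix_of_not_adj hw, zero_mul]

variable {φ}

section Cycle

variable {v : V} {c : G.Walk v v}

/-- The eigenvalue equation at an inner vertex of a cycle, in terms of the gauged vector. -/
theorem eigen_inner_iff (h2 : ∀ v, G.degree v = 2) (hc : c.IsCycle) (x : V → ℂ) (μ : ℂ)
    {i : ℕ} (hi : i + 2 ≤ c.length) :
    ∑ w, φ.adjMatrix (c.getVert (i + 1)) w * x w = μ * x (c.getVert (i + 1)) ↔
      φ.prefixGain c i * x (c.getVert i) + φ.prefixGain c (i + 2) * x (c.getVert (i + 2))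
        = μ * (φ.prefixGain c (i + 1) * x (c.getVert (i + 1))) := by
  have h1 : G.Adj (c.getVert (i + 1)) (c.getVert i) := (c.adj_getVert_succ (by omega)).symm
  have h3 : G.Adj (c.getVert (i + 1)) (c.getVert (i + 2)) := c.adj_getVert_succ (by omega)
  have hne : c.getVert i ≠ c.getVert (i + 2) :=
    hc.getVert_sub_one_ne_getVert_add_one (i := i + 1) (by omega)
  rw [φ.sum_adjMatrix_of_degree_eq_two h2 h1 h3 hne,
    ← mul_right_inj' (prefixGain_ne_zero (φ := φ) c (i := i + 1) (by omega)),
    ← prefixGain_succ_mul_adjMatrix (φ := φ) c (i := i) (by omega), prefixGain_succ c (i + 1)]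
  constructor <;> intro h <;> linear_combination h

/-- The eigenvalue equation at the base vertex of a cycle, in terms of the gauged vector. -/
theorem eigen_base_iff (h2 : ∀ v, G.degree v = 2) (hc : c.IsCycle) (x : V → ℂ) (μ : ℂ)
    {m : ℕ} (hm : c.length = m + 1) :
    ∑ w, φ.adjMatrix v w * x w = μ * x v ↔
      φ.prefixGain c m * x (c.getVert m)
        + φ.walkGain c * (φ.prefixGain c 1 * x (c.getVert 1)) = μ * (φ.walkGain c * x v) := by
  have h3 := hc.three_le_length
  have hend : c.getVert (m + 1) = v := by rw [← hm, Walk.getVert_length]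
  have h0 : G.Adj v (c.getVert 1) := by
    have := c.adj_getVert_succ (i := 0) (by omega)
    simpa using this
  have h1 : G.Adj v (c.getVert m) := by
    have := c.adj_getVert_succ (i := m) (by omega)
    rw [hend] at this
    exact this.symm
  have hne : c.getVert m ≠ c.getVert 1 := by
    intro h
    have := hc.getVert_injOn' (by simp; omega) (by simp; omega) h
    omega
  have hg : (φ.walkGain c : ℂ) ≠ 0 := Circle.coe_ne_zero _
  have hp1 : φ.prefixGain c 1 = φ.adjMatrix v (c.getVert 1) := by
    rw [prefixGain_succ, prefixGain_zero, one_mul, Walk.getVert_zero]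
  have hpm : φ.prefixGain c m = φ.walkGain c * φ.adjMatrix v (c.getVert m) := by
    have := prefixGain_succ_mul_adjMatrix (φ := φ) c (i := m) (by omega)
    rw [hend, ← hm, prefixGain_length] at this
    exact this.symm
  rw [φ.sum_adjMatrix_of_degree_eq_two h2 h1 h0 hne, ← mul_right_inj' hg, hp1, hpm]
  constructor <;> intro h <;> linear_combination h

/-- The pair `(y 0, y 1)` determines an eigenvector, so a two-dimensional eigenspace realises all
initial data. Applied to the solutions `t ^ i` and `t⁻¹ ^ i`, the closing condition `y n = g y 0`
yields both power equations. -/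
theorem exists_root_of_two_le_adjMult (h2 : ∀ v, G.degree v = 2) (hc : c.IsHamiltonianCycle)
    {μ : ℂ} (hμ : 2 ≤ φ.adjMult μ) :
    ∃ t : ℂ, t ≠ 0 ∧ t ^ 2 ≠ 1 ∧ t + t⁻¹ = μ ∧ t ^ c.length = φ.walkGain c ∧
      t⁻¹ ^ c.length = φ.walkGain c := by
  have h3 := hc.isCycle.three_le_length
  rw [adjMult_eq_finrank_ker] at hμ
  set E := LinearMap.ker (φ.adjMatrix - μ • (1 : Matrix V V ℂ)).mulVecLin with hE
  set y : (V → ℂ) → ℕ → ℂ := fun x i => φ.prefixGain c i * x (c.getVert i) with hy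
  have hrec : ∀ x ∈ E, ∀ i, i + 2 ≤ c.length → y x i + y x (i + 2) = μ * y x (i + 1) :=
    fun x hx i hi => (eigen_inner_iff h2 hc.isCycle x μ hi).1 (mem_ker_sub_smul_one_iff.1 hx _)
  have hend : ∀ x, y x c.length = φ.walkGain c * y x 0 := by
    intro x
    simp only [hy, prefixGain_length, Walk.getVert_length, prefixGain_zero, Walk.getVert_zero,
      one_mul]
  have huniq : ∀ x ∈ E, ∀ s : ℕ → ℂ, (∀ i, s i + s (i + 2) = μ * s (i + 1)) → y x 0 = s 0 →
      y x 1 = s 1 → ∀ i ≤ c.length, y x i = s i := by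
    intro x hx s hs h0 h1 i
    induction i using Nat.strong_induction_on with
    | _ i ih =>
    intro hi
    match i, ih, hi with
    | 0, _, _ => exact h0
    | 1, _, _ => exact h1
    | i + 2, ih, hi =>
      have e1 := hrec x hx i hi
      have e2 := hs i
      rw [ih i (by omega) (by omega), ih (i + 1) (by omega) (by omega)] at e1
      linear_combination e1 - e2
  have hsurj : ∀ p q : ℂ, ∃ x ∈ E, y x 0 = p ∧ y x 1 = q := by
    let ev : E →ₗ[ℂ] ℂ × ℂ :=
      { toFun := fun x => (y x 0, y x 1)
        map_add' := fun a b => by simp [hy, mul_add]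
        map_smul' := fun r a => by
          simp only [hy, SetLike.val_smul, Pi.smul_apply, smul_eq_mul, RingHom.id_apply,
            Prod.smul_mk, Prod.mk.injEq]
          constructor <;> ring }
    have hinj : Function.Injective ev := by
      rw [← LinearMap.ker_eq_bot, LinearMap.ker_eq_bot']
      intro x hx
      have h0 : y x 0 = 0 := congrArg Prod.fst hx
      have h1 : y x 1 = 0 := congrArg Prod.snd hx
      have hall := huniq x x.2 (fun _ => 0) (by simp) h0 h1
      ext w
      obtain ⟨i, hi, hil⟩ := Walk.mem_support_iff_exists_getVert.1 (hc.mem_support w)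
      have := hall i hil
      simp only [hy, mul_eq_zero, prefixGain_ne_zero c hil, false_or, hi] at this
      simpa using this
    have hfr : finrank ℂ E = finrank ℂ (ℂ × ℂ) := by
      apply le_antisymm (LinearMap.finrank_le_finrank_of_injective hinj)
      simpa using hμ
    have hsur := (LinearMap.injective_iff_surjective_of_finrank_eq_finrank hfr).1 hinj
    intro p q
    obtain ⟨x, hx⟩ := hsur (p, q)
    exact ⟨x, x.2, congrArg Prod.fst hx, congrArg Prod.snd hx⟩
  have hpow : ∀ t : ℂ, t ^ 2 + 1 = μ * t → t ^ c.length = φ.walkGain c := by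
    intro t ht
    obtain ⟨x, hx, h0, h1⟩ := hsurj 1 t
    have := huniq x hx (fun i => t ^ i) (fun i => by
      simp only [pow_succ]; linear_combination t ^ i * ht) (by simpa using h0)
      (by simpa using h1) c.length le_rfl
    rw [← this, hend, h0, mul_one]
  obtain ⟨t, ht⟩ : ∃ t : ℂ, t ^ 2 + 1 = μ * t := by
    obtain ⟨t, ht⟩ := exists_quadratic_eq_zero (a := (1 : ℂ)) (b := -μ) (c := 1) one_ne_zero
      (IsAlgClosed.exists_eq_mul_self _)
    exact ⟨t, by linear_combination ht⟩
  have ht0 : t ≠ 0 := by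
    rintro rfl
    simp at ht
  have htμ : t + t⁻¹ = μ := by
    field_simp
    linear_combination ht
  refine ⟨t, ht0, ?_, htμ, hpow t ht, hpow t⁻¹ ?_⟩
  · intro ht1
    obtain ⟨x, hx, h0, h1⟩ := hsurj 0 1
    have hμt : μ = 2 * t := by
      have : μ * t ^ 2 = 2 * t := by linear_combination -t * ht + t * ht1
      rwa [ht1, mul_one] at this
    -- If `t` is a double root, `i t ^ i` is also a solution; the extra factor `t` makes its value
    -- at `1` equal to `t ^ 2 = 1`. It vanishes at `0` but not at `n`, so it cannot close up.
    have := huniq x hx (fun i => i * t ^ (i + 1)) (fun i => by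
      rw [hμt]
      push_cast
      simp only [pow_succ]
      linear_combination (-(i : ℂ) * t ^ i * t) * ht1) (by simpa using h0)
      (by simpa [ht1] using h1) c.length le_rfl
    rw [hend, h0, mul_zero, eq_comm, mul_eq_zero] at this
    rcases this with h | h
    · have : c.length = 0 := by exact_mod_cast h
      omega
    · exact ht0 (pow_eq_zero_iff (by omega) |>.1 h)
  · rw [← htμ]
    field_simp
    ring

/-- The gauged vectors `t ^ i` and `t⁻¹ ^ i` both close up, and `t ≠ t⁻¹` makes them independent. -/
theorem two_le_adjMult_of_root (h2 : ∀ v, G.degree v = 2) (hc : c.IsHamiltonianCycle)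
    {t : ℂ} (ht0 : t ≠ 0) (ht1 : t ^ 2 ≠ 1) (hg : t ^ c.length = φ.walkGain c)
    (hg' : t⁻¹ ^ c.length = φ.walkGain c) : 2 ≤ φ.adjMult (t + t⁻¹) := by
  have h3 := hc.isCycle.three_le_length
  rw [adjMult_eq_finrank_ker]
  set E := LinearMap.ker (φ.adjMatrix - (t + t⁻¹) • (1 : Matrix V V ℂ)).mulVecLin with hE
  obtain ⟨m, hm⟩ : ∃ m, c.length = m + 1 := ⟨c.length - 1, by omega⟩
  have hidx : ∀ u : V, ∃ i, i < c.length ∧ c.getVert i = u := by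
    intro u
    obtain ⟨i, hi, hil⟩ := Walk.mem_support_iff_exists_getVert.1 (hc.mem_support u)
    rcases hil.lt_or_eq with h | h
    · exact ⟨i, h, hi⟩
    · exact ⟨0, by omega, by rw [← hi, h, Walk.getVert_length, Walk.getVert_zero]⟩
  choose idx hidx1 hidx2 using hidx
  have hidx3 : ∀ i < c.length, idx (c.getVert i) = i := fun i hi =>
    hc.isCycle.getVert_injOn' (by simp; have := hidx1 (c.getVert i); omega) (by simp; omega)
      (hidx2 _)
  have key : ∀ s : ℂ, s ≠ 0 → s ^ c.length = φ.walkGain c →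
      ∃ x : V → ℂ, (∀ i ≤ c.length, φ.prefixGain c i * x (c.getVert i) = s ^ i) ∧
        ∀ u, ∑ w, φ.adjMatrix u w * x w = (s + s⁻¹) * x u := by
    intro s hs hsg
    have hval : ∃ x : V → ℂ, ∀ i ≤ c.length, φ.prefixGain c i * x (c.getVert i) = s ^ i := by
      refine ⟨fun u => (φ.prefixGain c (idx u))⁻¹ * s ^ idx u, fun i hi => ?_⟩
      -- The index `c.length` returns to the base vertex, where consistency is exactly `s ^ n = g`.
      rcases hi.lt_or_eq with h | h
      · simp only [hidx3 i h]
        rw [mul_inv_cancel_left₀ (prefixGain_ne_zero c hi)]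
      · have h0 : idx v = 0 := by
          have := hidx3 0 (by omega)
          rwa [Walk.getVert_zero] at this
        beta_reduce
        rw [h, Walk.getVert_length, h0, prefixGain_length, hsg, prefixGain_zero]
        simp
    obtain ⟨x, hx⟩ := hval
    refine ⟨x, hx, fun u => ?_⟩
    obtain ⟨i, hi, rfl⟩ : ∃ i, i < c.length ∧ c.getVert i = u := ⟨idx u, hidx1 u, hidx2 u⟩
    match i, hi with
    | 0, hi =>
      have hv : x v = 1 := by
        have := hx 0 (by omega)
        simpa [prefixGain_zero] using this
      rw [Walk.getVert_zero, eigen_base_iff h2 hc.isCycle x _ hm, hx m (by omega),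
        hx 1 (by omega), hv, ← hsg, hm]
      field_simp
      ring
    | i + 1, hi =>
      rw [eigen_inner_iff h2 hc.isCycle x _ (by omega), hx i (by omega), hx (i + 1) (by omega),
        hx (i + 2) (by omega)]
      field_simp
      ring
  obtain ⟨x, hx, hxE⟩ := key t ht0 hg
  obtain ⟨x', hx', hxE'⟩ := key t⁻¹ (inv_ne_zero ht0) hg'
  rw [inv_inv, add_comm t⁻¹] at hxE'
  let f : Fin 2 → E := ![⟨x, mem_ker_sub_smul_one_iff.2 hxE⟩, ⟨x', mem_ker_sub_smul_one_iff.2 hxE'⟩]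
  have hli : LinearIndependent ℂ f := by
    rw [LinearIndependent.pair_iff]
    intro p q hpq
    have hpq' : ∀ u, p * x u + q * x' u = 0 := fun u => by
      simpa using congrFun (congrArg Subtype.val hpq) u
    have e0 : p + q = 0 := by
      have a := hx 0 (by omega)
      have b := hx' 0 (by omega)
      simp only [prefixGain_zero, one_mul, pow_zero] at a b
      have := hpq' (c.getVert 0)
      rw [a, b] at this
      linear_combination this
    have e1 : p * t + q * t⁻¹ = 0 := by
      have a := hx 1 (by omega)
      have b := hx' 1 (by omega)
      rw [pow_one] at a b
      linear_combination φ.prefixGain c 1 * hpq' (c.getVert 1) - p * a - q * b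
    have hp : p * (t ^ 2 - 1) = 0 := by
      have : p * t ^ 2 + q = 0 := by
        field_simp at e1
        linear_combination e1
      linear_combination this - e0
    have hp0 : p = 0 := (mul_eq_zero.1 hp).resolve_right (sub_ne_zero.2 ht1)
    exact ⟨hp0, by simpa [hp0] using e0⟩
  simpa using hli.fintype_card_le_finrank

end Cycle

end UnitGain

/-! ### Roots of `1` and `-1` in terms of cosines. -/

namespace Complex

theorem exp_mul_I_add_inv (θ : ℝ) :
    exp (θ * I) + (exp (θ * I))⁻¹ = ((2 * Real.cos θ : ℝ) : ℂ) := by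
  rw [← exp_neg, ← neg_mul, ← two_cos]
  push_cast
  rfl

theorem exp_mul_I_sq_ne_one {θ : ℝ} (h0 : 0 < θ) (hπ : θ < Real.pi) : exp (θ * I) ^ 2 ≠ 1 := by
  intro h
  refine (Real.sin_pos_of_pos_of_lt_pi h0 hπ).ne' ?_
  rw [← exp_ofReal_mul_I_im]
  rcases sq_eq_one_iff.1 h with h | h <;> simp [h]

end Complex

/-- The exponents `k` and `n - k` give the same `t + t⁻¹`, so `k` may be folded below `n / 2`; `t ^
2 ≠ 1` removes `k = 0` and `k = n / 2`. -/
theorem exists_cos_of_pow_eq_one {n : ℕ} (hn : n ≠ 0) {t : ℂ} (ht : t ^ n = 1)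
    (ht2 : t ^ 2 ≠ 1) : ∃ j : ℕ, 1 ≤ j ∧ 2 * j < n ∧
      t + t⁻¹ = ((2 * Real.cos (2 * Real.pi * j / n) : ℝ) : ℂ) := by
  have : NeZero n := ⟨hn⟩
  have hn' : (n : ℂ) ≠ 0 := by exact_mod_cast hn
  have hnr : (n : ℝ) ≠ 0 := by exact_mod_cast hn
  obtain ⟨k, hk, rfl⟩ := (Complex.isPrimitiveRoot_exp n hn).eq_pow_of_pow_eq_one ht
  have hexp : Complex.exp (2 * Real.pi * Complex.I / n) ^ k
      = Complex.exp ((2 * Real.pi * k / n : ℝ) * Complex.I) := by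
    rw [← Complex.exp_nat_mul]
    congr 1
    push_cast
    field_simp
  have hsum := Complex.exp_mul_I_add_inv (2 * Real.pi * k / n)
  rw [← hexp] at hsum
  have hprim := Complex.isPrimitiveRoot_exp n hn
  have hk2 : ¬ n ∣ k * 2 := fun h => ht2 (by rw [← pow_mul, hprim.pow_eq_one_iff_dvd]; exact h)
  have hk0 : k ≠ 0 := by rintro rfl; simp at hk2
  have hkn : k * 2 ≠ n := fun h => hk2 (h ▸ dvd_rfl)
  rcases Nat.lt_or_gt_of_ne hkn with h | h
  · exact ⟨k, by omega, by omega, hsum⟩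
  · refine ⟨n - k, by omega, by omega, ?_⟩
    rw [hsum]
    congr 2
    rw [← Real.cos_two_pi_sub]
    congr 1
    push_cast [Nat.cast_sub hk.le]
    field_simp

/-- Division by `exp (πi / n)` reduces to roots of unity. Folding is now `k ↦ n - 1 - k`, and its
fixed point `2 k + 1 = n` is the excluded `t = -1`. -/
theorem exists_cos_of_pow_eq_neg_one {n : ℕ} (hn : n ≠ 0) {t : ℂ} (ht : t ^ n = -1)
    (ht2 : t ^ 2 ≠ 1) : ∃ j : ℕ, 2 * j + 1 < n ∧
      t + t⁻¹ = ((2 * Real.cos ((2 * j + 1) * Real.pi / n) : ℝ) : ℂ) := by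
  have : NeZero n := ⟨hn⟩
  have hn' : (n : ℂ) ≠ 0 := by exact_mod_cast hn
  have hnr : (n : ℝ) ≠ 0 := by exact_mod_cast hn
  set r : ℂ := Complex.exp (Real.pi * Complex.I / n) with hr
  have hrn : r ^ n = -1 := by
    rw [hr, ← Complex.exp_nat_mul, mul_div_cancel₀ _ hn', Complex.exp_pi_mul_I]
  have hr0 : r ≠ 0 := Complex.exp_ne_zero _
  obtain ⟨k, hk, hkt⟩ := (Complex.isPrimitiveRoot_exp n hn).eq_pow_of_pow_eq_one
    (ξ := t / r) (by rw [div_pow, ht, hrn]; norm_num)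
  have hexp : t = Complex.exp (((2 * k + 1) * Real.pi / n : ℝ) * Complex.I) := by
    rw [eq_div_iff hr0] at hkt
    rw [← hkt, hr, ← Complex.exp_nat_mul, ← Complex.exp_add]
    congr 1
    push_cast
    field_simp
  have hsum := Complex.exp_mul_I_add_inv ((2 * k + 1) * Real.pi / n)
  rw [← hexp] at hsum
  have hkn : 2 * k + 1 ≠ n := by
    intro h
    refine ht2 ?_
    have : ((2 * k + 1) * Real.pi / n : ℝ) = Real.pi := by
      rw [← h] at hnr ⊢
      push_cast at hnr ⊢
      field_simp
    rw [hexp, this, Complex.exp_pi_mul_I]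
    norm_num
  rcases Nat.lt_or_gt_of_ne hkn with h | h
  · exact ⟨k, h, hsum⟩
  · refine ⟨n - 1 - k, by omega, ?_⟩
    rw [hsum]
    congr 2
    rw [← Real.cos_two_pi_sub]
    congr 1
    have : ((n - 1 - k : ℕ) : ℝ) = n - 1 - k := by
      rw [Nat.cast_sub (by omega), Nat.cast_sub (by omega), Nat.cast_one]
    rw [this]
    field_simp
    ring

/-! ### Complete bipartite graphs. -/

namespace SimpleGraph

variable {V : Type*} [Fintype V] [DecidableEq V] {G : SimpleGraph V} [DecidableRel G.Adj]

namespace IsBipartiteWitness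

variable {a b : V}

omit [DecidableEq V] in
theorem adj_iff_of_left (h : G.IsBipartiteWitness a b) {x : V} (hx : G.Adj a x) (y : V) :
    G.Adj x y ↔ G.Adj b y := by
  rw [← mem_neighborFinset, h.left x hx, mem_neighborFinset]

omit [DecidableEq V] in
theorem adj_iff_of_right (h : G.IsBipartiteWitness a b) {x : V} (hx : G.Adj b x) (y : V) :
    G.Adj x y ↔ G.Adj a y := by
  rw [← mem_neighborFinset, h.right x hx, mem_neighborFinset]

omit [DecidableEq V] in
theorem not_adj_right_iff (h : G.IsBipartiteWitness a b) (x : V) :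
    ¬ G.Adj b x ↔ G.Adj a x :=
  ⟨fun hx => (h.cover x).resolve_right hx, fun hx => h.disj x hx⟩

omit [DecidableEq V] in
theorem card_eq_and_nonempty_iso (h : G.IsBipartiteWitness a b) {d : ℕ}
    (hd : ∀ v, G.degree v = d) : Fintype.card V = 2 * d ∧
      Nonempty (G ≃g completeBipartiteGraph (Fin d) (Fin d)) := by
  have hcard : ∀ u, Fintype.card {x // G.Adj u x} = d := fun u => by
    rw [Fintype.card_subtype, ← neighborFinset_eq_filter, card_neighborFinset_eq_degree, hd]
  have hcard' : Fintype.card {x // ¬ G.Adj b x} = d := by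
    rw [← hcard a]
    exact Fintype.card_congr (Equiv.subtypeEquivRight h.not_adj_right_iff)
  let e : V ≃ Fin d ⊕ Fin d := (Equiv.sumCompl (G.Adj b)).symm.trans
    (Equiv.sumCongr (Fintype.equivFinOfCardEq (hcard b)) (Fintype.equivFinOfCardEq hcard'))
  have hl : ∀ x, (e x).isLeft = true ↔ G.Adj b x := by
    intro x
    by_cases hx : G.Adj b x
    · simp [e, hx, Equiv.sumCompl_symm_apply_of_pos hx]
    · simp [e, hx, Equiv.sumCompl_symm_apply_of_neg hx]
  have hr : ∀ x, (e x).isRight = true ↔ G.Adj a x := by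
    intro x
    rw [← h.not_adj_right_iff x, ← hl x, ← Sum.not_isLeft]
  refine ⟨by simpa [two_mul] using Fintype.card_congr e, ⟨⟨e, ?_⟩⟩⟩
  intro x y
  change (_ ∧ _ ∨ _ ∧ _) ↔ _
  rw [hl, hl, hr, hr]
  rcases h.cover x with hx | hx
  · rw [h.adj_iff_of_left hx]
    have := h.disj x hx
    tauto
  · rw [h.adj_iff_of_right hx]
    have := fun hx' => h.disj x hx' hx
    tauto

end IsBipartiteWitness

omit [DecidableEq V] in
theorem degree_eq_of_iso_completeBipartiteGraph {m : ℕ}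
    (e : G ≃g completeBipartiteGraph (Fin m) (Fin m)) (v : V) : G.degree v = m := by
  classical
  rw [degree_eq_of_iso e v, ← card_neighborFinset_eq_degree]
  cases e v with
  | inl i =>
    have : (completeBipartiteGraph (Fin m) (Fin m)).neighborFinset (Sum.inl i)
        = Finset.univ.map Function.Embedding.inr := by
      ext x
      cases x <;> simp
    rw [this]
    simp
  | inr i =>
    have : (completeBipartiteGraph (Fin m) (Fin m)).neighborFinset (Sum.inr i)
        = Finset.univ.map Function.Embedding.inl := by
      ext x
      cases x <;> simp
    rw [this]
    simp

end SimpleGraph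

namespace UnitGain

variable {V : Type*} [Fintype V] [DecidableEq V] {G : SimpleGraph V} [DecidableRel G.Adj]
  (φ : UnitGain G)

/-- If the rank of `A(Φ) - μ` on a complete bipartite graph is two, then the rows of the left part
are proportional and `μ = 0`. -/
theorem eq_zero_and_switchingEquiv_of_rank_eq_two {a b : V} (h : G.IsBipartiteWitness a b)
    (hd : ∀ v, 3 ≤ G.degree v) {μ : ℂ} (hr : (φ.adjMatrix - μ • (1 : Matrix V V ℂ)).rank = 2) :
    μ = 0 ∧ φ.SwitchingEquiv (trivial G) := by
  set N := φ.adjMatrix - μ • (1 : Matrix V V ℂ) with hN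
  have hoff : ∀ x y, x ≠ y → N x y = φ.adjMatrix x y := fun x y hxy => by
    simp [hN, Matrix.one_apply_ne hxy]
  have hdiag : ∀ x, N x x = -μ := fun x => by
    simp [hN, φ.adjMatrix_of_not_adj (G.loopless.irrefl x)]
  have hzero : ∀ x y, x ≠ y → ¬ G.Adj x y → N x y = 0 := fun x y hxy hadj => by
    rw [hoff x y hxy, φ.adjMatrix_of_not_adj hadj]
  have hnz : ∀ x y, G.Adj x y → N x y ≠ 0 := fun x y hadj => by
    rw [hoff x y hadj.ne]
    exact φ.adjMatrix_ne_zero_iff.2 hadj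
  have hexists : ∀ u x y : V, ∃ w, G.Adj u w ∧ w ≠ x ∧ w ≠ y := by
    intro u x y
    obtain ⟨w, hw, hw'⟩ := Finset.exists_mem_notMem_of_card_lt_card
      (s := {x, y}) (t := G.neighborFinset u) (by
        have := hd u
        rw [card_neighborFinset_eq_degree]
        exact lt_of_le_of_lt Finset.card_le_two (by omega))
    simp only [Finset.mem_insert, Finset.mem_singleton, not_or] at hw'
    exact ⟨w, by simpa using hw, hw'⟩
  have hna : ∀ x y, G.Adj b x → G.Adj b y → ¬ G.Adj x y := fun x y hx hy hxy =>
    h.disj y ((h.adj_iff_of_right hx y).1 hxy) hy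
  have hnb : ∀ x y, G.Adj a x → G.Adj a y → ¬ G.Adj x y := fun x y hx hy hxy =>
    h.disj y hy ((h.adj_iff_of_left hx y).1 hxy)
  have hba := h.adj.symm
  -- Rows `a` and `b` are independent, so by `hr` they span the row space.
  have hspan : Submodule.span ℂ {N.row a, N.row b} = Submodule.span ℂ (Set.range N.row) := by
    refine Submodule.eq_of_le_of_finrank_le (Submodule.span_mono ?_) ?_
    · rintro _ (rfl | rfl) <;> exact ⟨_, rfl⟩
    · rw [← Matrix.rank_eq_finrank_span_row, hr]
      have hli : LinearIndependent ℂ ![N.row a, N.row b] := by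
        rw [LinearIndependent.pair_iff]
        intro s t hst
        obtain ⟨w, hw, hwa, -⟩ := hexists b a a
        obtain ⟨w', hw', hwb, -⟩ := hexists a b b
        have e1 : s * N a w + t * N b w = 0 := congrFun hst w
        have e2 : s * N a w' + t * N b w' = 0 := congrFun hst w'
        rw [hzero a w hwa.symm (hna a w hba hw), mul_zero, zero_add] at e1
        rw [hzero b w' hwb.symm (hnb b w' h.adj hw'), mul_zero, add_zero] at e2
        exact ⟨(mul_eq_zero.1 e2).resolve_right (hnz a w' hw'),
          (mul_eq_zero.1 e1).resolve_right (hnz b w hw)⟩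
      have := finrank_span_eq_card hli
      rw [Matrix.range_cons, Matrix.range_cons, Matrix.range_empty, Set.union_empty,
        Set.singleton_union] at this
      rw [this]
      simp
  have hprop : ∀ x, G.Adj b x → x ≠ a → ∃ s : ℂ, ∀ y, N x y = s * N a y := by
    intro x hx hxa
    have hmem : N.row x ∈ Submodule.span ℂ {N.row a, N.row b} := by
      rw [hspan]
      exact Submodule.subset_span ⟨x, rfl⟩
    obtain ⟨s, t, hst⟩ := Submodule.mem_span_pair.1 hmem
    have hst' : ∀ y, s * N a y + t * N b y = N x y := fun y => congrFun hst y
    -- At a neighbour `w` of `b` other than `a` and `x`, rows `a` and `x` vanish and row `b` does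
    -- not, so `t = 0`. Degree at least `3` provides `w`.
    obtain ⟨w, hw, hwa, hwx⟩ := hexists b a x
    have e1 := hst' w
    rw [hzero a w hwa.symm (hna a w hba hw), hzero x w hwx.symm (hna x w hx hw), mul_zero,
      zero_add, mul_eq_zero] at e1
    have ht := e1.resolve_right (hnz b w hw)
    exact ⟨s, fun y => by rw [← hst' y, ht]; ring⟩
  constructor
  · obtain ⟨x, hx, hxa, -⟩ := hexists b a a
    obtain ⟨s, hs⟩ := hprop x hx hxa
    have e1 := hs a
    have e2 := hs b
    rw [hzero x a hxa (hna x a hx hba), hdiag, eq_comm, mul_eq_zero] at e1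
    rcases e1 with rfl | h1
    · rw [zero_mul] at e2
      exact absurd e2 (hnz x b hx.symm)
    · exact neg_eq_zero.1 h1
  · have hcross : ∀ x y (hx : G.Adj b x) (hy : G.Adj a y) (hxy : G.Adj x y),
        φ.gain ⟨(x, y), hxy⟩ * φ.gain ⟨(a, b), h.adj⟩
          = φ.gain ⟨(x, b), hx.symm⟩ * φ.gain ⟨(a, y), hy⟩ := by
      intro x y hx hy hxy
      by_cases hxa : x = a
      · subst hxa
        exact mul_comm _ _
      obtain ⟨s, hs⟩ := hprop x hx hxa
      apply Circle.ext
      rw [Circle.coe_mul, Circle.coe_mul, ← φ.adjMatrix_of_adj, ← φ.adjMatrix_of_adj,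
        ← φ.adjMatrix_of_adj, ← φ.adjMatrix_of_adj, ← hoff _ _ hxy.ne, ← hoff _ _ h.adj.ne,
        ← hoff _ _ hx.ne', ← hoff _ _ hy.ne, hs y, hs b]
      ring
    -- `ζ x` is the gain of the walk `a → b → x` or of the edge `a → x`, according to the side of
    -- `x`.
    let ζ : V → Circle := fun x => if hx : G.Adj b x then
        φ.gain ⟨(a, b), h.adj⟩ * (φ.gain ⟨(x, b), hx.symm⟩)⁻¹
      else φ.gain ⟨(a, x), (h.not_adj_right_iff x).1 hx⟩
    have hζ : ∀ x y (hx : G.Adj b x) (hy : G.Adj a y) (hxy : G.Adj x y),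
        φ.gain ⟨(x, y), hxy⟩ = (ζ x)⁻¹ * ζ y := by
      intro x y hx hy hxy
      have hy' : ¬ G.Adj b y := h.disj y hy
      simp only [ζ, hx, hy', dif_pos, dif_neg, not_false_eq_true]
      rw [mul_inv_rev, inv_inv, eq_comm, mul_right_comm, ← hcross x y hx hy hxy,
        mul_inv_cancel_right]
    refine ⟨ζ, ?_⟩
    rintro ⟨⟨x, y⟩, hxy⟩
    simp only [trivial, mul_one]
    rcases h.cover x with hx | hx
    · have hy : G.Adj b y := (h.adj_iff_of_left hx y).1 hxy
      have hxy' : G.Adj y x := hxy.symm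
      rw [φ.gain_swap hxy', hζ y x hy hx hxy', mul_inv_rev, inv_inv]
    · exact hζ x y hx ((h.adj_iff_of_right hx y).1 hxy) hxy

-- Up to switching the matrix depends only on the sides of its two indices, so it factors through
-- `Bool`.
omit [DecidableEq V] in
theorem rank_adjMatrix_le_two {m : ℕ} (e : G ≃g completeBipartiteGraph (Fin m) (Fin m))
    (h : φ.SwitchingEquiv (trivial G)) : φ.adjMatrix.rank ≤ 2 := by
  obtain ⟨ζ, hζ⟩ := h
  let B : Matrix Bool V ℂ := Matrix.of fun s w => if (e w).isLeft = s then (ζ w : ℂ) else 0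
  let C : Matrix V Bool ℂ :=
    Matrix.of fun u s => if (e u).isLeft = s then 0 else ((ζ u)⁻¹ : Circle)
  have hCB : φ.adjMatrix = C * B := by
    ext u w
    have hadj : G.Adj u w ↔ (e u).isLeft ≠ (e w).isLeft := by
      rw [← e.map_adj_iff]
      cases e u <;> cases e w <;> simp
    rw [Matrix.mul_apply, Fintype.sum_bool]
    by_cases huw : G.Adj u w
    · rw [φ.adjMatrix_of_adj huw, hζ]
      rw [hadj] at huw
      cases hu : (e u).isLeft <;> cases hw : (e w).isLeft <;>
        simp [B, C, hu, hw, trivial] at huw ⊢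
    · rw [φ.adjMatrix_of_not_adj huw]
      rw [hadj] at huw
      cases hu : (e u).isLeft <;> cases hw : (e w).isLeft <;>
        simp [B, C, hu, hw] at huw ⊢
  rw [hCB]
  exact (Matrix.rank_mul_le_right C B).trans (B.rank_le_card_height.trans (by simp))

end UnitGain

/-! ### From the real bound to `n ≤ r (Δ - 1) + 2`. -/

theorem natCast_sub_div_eq {k r n Δ : ℕ} (hΔ : 2 ≤ Δ) (hk : k + r = n) :
    (((Δ : ℝ) - 2) * n + 2) / ((Δ : ℝ) - 1) - k
      = (((r * (Δ - 1) + 2 : ℕ) : ℝ) - n) / ((Δ : ℝ) - 1) := by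
  obtain ⟨D, rfl⟩ := Nat.exists_eq_add_of_le' hΔ
  have hD : ((D + 2 : ℕ) : ℝ) - 1 ≠ 0 := by
    have : (0 : ℝ) ≤ D := Nat.cast_nonneg D
    push_cast
    linarith
  subst hk
  rw [show D + 2 - 1 = D + 1 by omega, div_sub' hD]
  congr 1
  push_cast
  ring

theorem natCast_le_div_iff {k r n Δ : ℕ} (hΔ : 2 ≤ Δ) (hk : k + r = n) :
    (k : ℝ) ≤ (((Δ : ℝ) - 2) * n + 2) / ((Δ : ℝ) - 1) ↔ n ≤ r * (Δ - 1) + 2 := by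
  have hΔ' : (0 : ℝ) < (Δ : ℝ) - 1 := by
    have : (2 : ℝ) ≤ Δ := by exact_mod_cast hΔ
    linarith
  rw [← sub_nonneg, natCast_sub_div_eq hΔ hk, le_div_iff₀ hΔ', zero_mul, sub_nonneg,
    Nat.cast_le]

theorem natCast_eq_div_iff {k r n Δ : ℕ} (hΔ : 2 ≤ Δ) (hk : k + r = n) :
    (k : ℝ) = (((Δ : ℝ) - 2) * n + 2) / ((Δ : ℝ) - 1) ↔ n = r * (Δ - 1) + 2 := by
  have hΔ' : (Δ : ℝ) - 1 ≠ 0 := by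
    have : (2 : ℝ) ≤ Δ := by exact_mod_cast hΔ
    linarith
  rw [eq_comm, ← sub_eq_zero, natCast_sub_div_eq hΔ hk, div_eq_zero_iff, or_iff_left hΔ',
    sub_eq_zero, Nat.cast_inj, eq_comm]

/-! ### The main theorem and its cycle case. -/

namespace UnitGain

variable {V : Type*} [Fintype V] [DecidableEq V] {G : SimpleGraph V} [DecidableRel G.Adj]
  {φ : UnitGain G}

theorem IsCycleOfGain.degree_eq_two {g : ℂ} (h : φ.IsCycleOfGain g) (v : V) :
    G.degree v = 2 := by
  obtain ⟨⟨e⟩, u, c, hc, -⟩ := h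
  have h3 := hc.isCycle.three_le_length
  rw [hc.length_eq] at h3
  rw [degree_eq_of_iso e, cycleGraph_degree_of_three_le h3]

/-- A value `2 cos θ` is a double eigenvalue of a cycle of gain `exp (nθi)` if that gain is
`1` or `-1` and `0 < θ < π`. -/
theorem IsCycleOfGain.two_le_alphaMult {g : ℂ} (h : φ.IsCycleOfGain g) (hg : g * g = 1) {θ : ℝ}
    (hθ0 : 0 < θ) (hθπ : θ < Real.pi)
    (hθg : Complex.exp (θ * Complex.I) ^ Fintype.card V = g) {α : ℝ} (hα : α < 1) :
    2 ≤ φ.alphaMult α ((2 * α + 2 * (1 - α) * Real.cos θ : ℝ) : ℂ) := by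
  have h2 := h.degree_eq_two
  obtain ⟨-, v, c, hc, hcg⟩ := h
  have hα' : ((1 - α : ℝ) : ℂ) ≠ 0 := by exact_mod_cast (sub_pos.2 hα).ne'
  have hz : (((2 * α + 2 * (1 - α) * Real.cos θ : ℝ) : ℂ) - α * (2 : ℕ)) / ((1 - α : ℝ) : ℂ)
      = Complex.exp (θ * Complex.I) + (Complex.exp (θ * Complex.I))⁻¹ := by
    rw [Complex.exp_mul_I_add_inv, div_eq_iff hα']
    push_cast
    ring
  rw [φ.alphaMult_eq_adjMult_of_regular h2 hα, hz]
  rw [← hc.length_eq] at hθg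
  refine two_le_adjMult_of_root h2 hc (Complex.exp_ne_zero _)
    (Complex.exp_mul_I_sq_ne_one hθ0 hθπ) (hθg.trans hcg.symm) ?_
  rw [inv_pow, hθg, hcg]
  exact inv_eq_of_mul_eq_one_left hg

end UnitGain

theorem theorem3p4 {V : Type*} [Fintype V] [DecidableEq V]
    (G : SimpleGraph V) [DecidableRel G.Adj] (φ : UnitGain G)
    (n Δ : ℕ) (hn : Fintype.card V = n) (hΔ : G.maxDegree = Δ)
    (hconn : G.Connected) (hΔ2 : 2 ≤ Δ)
    (α : ℝ) (hα0 : 0 ≤ α) (hα1 : α < 1) (z : ℂ) :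
    (φ.alphaMult α z : ℝ) ≤ (((Δ : ℝ) - 2) * n + 2) / ((Δ : ℝ) - 1) ∧
    ((φ.alphaMult α z : ℝ) = (((Δ : ℝ) - 2) * n + 2) / ((Δ : ℝ) - 1) ↔
      ((G = ⊤ ∧ ∃ μ : ℂ, φ.adjMult μ = n - 1 ∧ z = α * ((n : ℂ) - 1) + (1 - α) * μ) ∨
       (φ.IsCycleOfGain 1 ∧ ∃ j : ℕ, 1 ≤ j ∧ j ≤ ⌈(n : ℝ) / 2⌉₊ - 1 ∧
          z = ((2 * α + 2 * (1 - α) * Real.cos (2 * Real.pi * j / n) : ℝ) : ℂ)) ∨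
       (φ.IsCycleOfGain (-1) ∧ ∃ j : ℕ, j ≤ ⌊(n : ℝ) / 2⌋₊ - 1 ∧
          z = ((2 * α + 2 * (1 - α) * Real.cos ((2 * j + 1) * Real.pi / n) : ℝ) : ℂ)) ∨
       ((∃ m : ℕ, n = 2 * m ∧ Nonempty (G ≃g completeBipartiteGraph (Fin m) (Fin m))) ∧
          φ.SwitchingEquiv (UnitGain.trivial G) ∧ z = α * (n : ℂ) / 2))) := by
  have := hconn.nonempty
  have hn3 : 3 ≤ n := by
    have := G.maxDegree_lt_card_verts
    omega
  have hn0 : (0 : ℝ) < n := by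
    have : 0 < n := by omega
    exact_mod_cast this
  have hα' : ((1 - α : ℝ) : ℂ) ≠ 0 := by exact_mod_cast (sub_pos.2 hα1).ne'
  have hG : ∀ v, (G.neighborFinset v).Nonempty := by
    intro v
    obtain ⟨u, hu, w, -, huw⟩ := hconn.exists_adj_notMem (F := {v}) ⟨v, by simp⟩ (by
      intro h
      have := congrArg Finset.card h
      rw [Finset.card_singleton, Finset.card_univ] at this
      omega)
    rw [Finset.mem_singleton] at hu
    exact ⟨w, by simpa [hu] using huw⟩
  have hsupp := φ.alphaMatrix_sub_apply_ne_zero_iff hα1 z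
  have hmult := φ.alphaMult_add_rank α z
  have hbound := card_le_rank_mul hsupp hG hconn (by omega)
  have htight := tightGrowth_of_card_eq hsupp hG hconn (by omega)
  set r := (φ.alphaMatrix α - z • (1 : Matrix V V ℂ)).rank with hr
  rw [hn] at hmult
  rw [hn, hΔ] at hbound
  rw [natCast_le_div_iff hΔ2 hmult, natCast_eq_div_iff hΔ2 hmult]
  refine ⟨hbound, ?_, ?_⟩
  · intro heq
    have H : G.TightGrowth := htight (by rw [hn, hΔ]; exact heq)
    have hdeg : ∀ v, G.degree v = Δ := fun v => (H.degree_eq (by omega) v).trans hΔ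
    have hadj := φ.alphaMult_eq_adjMult_of_regular hdeg hα1 z
    have hz : z = α * Δ + (1 - α) * ((z - α * Δ) / ((1 - α : ℝ) : ℂ)) := by
      rw [← Complex.ofReal_one, ← Complex.ofReal_sub, mul_div_cancel₀ _ hα']
      ring
    set μ := (z - α * Δ) / ((1 - α : ℝ) : ℂ) with hμ
    rcases hΔ2.lt_or_eq with hΔ3 | hΔ3
    · rcases H.eq_top_or_isBipartiteWitness (by omega) hconn with htop | ⟨a, b, hab⟩
      · left
        have hΔn : Δ = n - 1 := by
          obtain ⟨v⟩ := hconn.nonempty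
          rw [← hdeg v, ← hn]
          subst htop
          convert complete_graph_degree v
        have hr1 : r = 1 := by
          have h1 : r * (Δ - 1) = 1 * (Δ - 1) := by omega
          exact Nat.eq_of_mul_eq_mul_right (by omega) h1
        refine ⟨htop, μ, by omega, ?_⟩
        rw [hz, hΔn, Nat.cast_sub (by omega), Nat.cast_one]
      · right; right; right
        obtain ⟨hcard, hiso⟩ := hab.card_eq_and_nonempty_iso hdeg
        have hr2 : r = 2 := by
          have h1 : r * (Δ - 1) = 2 * (Δ - 1) := by omega
          exact Nat.eq_of_mul_eq_mul_right (by omega) h1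
        have hrank : (φ.adjMatrix - μ • (1 : Matrix V V ℂ)).rank = 2 := by
          have := φ.adjMult_add_rank μ
          omega
        obtain ⟨hμ0, hsw⟩ := φ.eq_zero_and_switchingEquiv_of_rank_eq_two hab
          (fun v => by rw [hdeg v]; omega) hrank
        refine ⟨⟨Δ, by omega, hiso⟩, hsw, ?_⟩
        rw [hz, hμ0, ← hn, hcard]
        push_cast
        ring
    · right
      have h2 : ∀ v, G.degree v = 2 := fun v => (hdeg v).trans hΔ3.symm
      obtain ⟨v, c, hc⟩ := exists_isHamiltonianCycle_of_degree_eq_two hconn h2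
      have hiso := nonempty_iso_cycleGraph h2 hc
      have hlen : c.length = n := hc.length_eq.trans hn
      obtain ⟨t, ht0, ht2, htμ, htg, htg'⟩ :=
        UnitGain.exists_root_of_two_le_adjMult (φ := φ) (μ := μ) h2 hc (by
          rw [← hΔ3] at heq
          omega)
      rw [hlen] at htg htg'
      have hg : (φ.walkGain c : ℂ) ^ 2 = 1 := by
        rw [sq]
        nth_rw 1 [← htg]
        rw [← htg', ← mul_pow, mul_inv_cancel₀ ht0, one_pow]
      rcases sq_eq_one_iff.1 hg with hg | hg
      · left
        obtain ⟨j, hj1, hj, hcos⟩ := exists_cos_of_pow_eq_one (by omega) (htg.trans hg) ht2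
        refine ⟨⟨hiso, v, c, hc, hg⟩, j, hj1, ?_, ?_⟩
        · refine Nat.le_sub_one_of_lt (Nat.lt_ceil.2 ?_)
          have : ((2 * j : ℕ) : ℝ) < n := by exact_mod_cast hj
          push_cast at this
          linarith
        · rw [hz, ← htμ, hcos, ← hΔ3]
          push_cast
          ring
      · right; left
        obtain ⟨j, hj, hcos⟩ := exists_cos_of_pow_eq_neg_one (by omega) (htg.trans hg) ht2
        refine ⟨⟨hiso, v, c, hc, hg⟩, j, ?_, ?_⟩
        · refine Nat.le_sub_one_of_lt (Nat.le_floor ?_)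
          have : ((2 * j + 2 : ℕ) : ℝ) ≤ n := by exact_mod_cast hj
          push_cast at this ⊢
          linarith
        · rw [hz, ← htμ, hcos, ← hΔ3]
          push_cast
          ring
  -- For `Δ = 2` the bound is itself `2`, so multiplicity at least `2` suffices.
  · have hcycle : ∀ g : ℂ, φ.IsCycleOfGain g → 2 ≤ φ.alphaMult α z →
        n = r * (Δ - 1) + 2 := by
      intro g hg hle
      have hΔeq : Δ = 2 := hΔ ▸ IsRegularOfDegree.maxDegree_eq G hg.degree_eq_two
      subst hΔeq
      omega
    rintro (⟨htop, μ, hμ, hz⟩ | ⟨hcyc, j, hj1, hj, hz⟩ | ⟨hcyc, j, hj, hz⟩ |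
      ⟨⟨m, hm, ⟨e⟩⟩, hsw, hz⟩)
    · have hdeg : ∀ v, G.degree v = n - 1 := by
        intro v
        rw [← hn]
        subst htop
        convert complete_graph_degree v
      have hΔeq : Δ = n - 1 := hΔ ▸ IsRegularOfDegree.maxDegree_eq G hdeg
      have hadj := φ.alphaMult_eq_adjMult_of_regular hdeg hα1 z
      have hzμ : (z - α * (n - 1 : ℕ)) / ((1 - α : ℝ) : ℂ) = μ := by
        rw [div_eq_iff hα', hz, Nat.cast_sub (by omega)]
        push_cast
        ring
      rw [hzμ, hμ] at hadj
      have hr1 : r = 1 := by omega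
      rw [hr1, hΔeq]
      omega
    · refine hcycle 1 hcyc ?_
      rw [hz]
      have hj' : (j : ℝ) < n / 2 := Nat.lt_ceil.1 (by omega)
      have hj0 : (0 : ℝ) < j := by exact_mod_cast hj1
      refine hcyc.two_le_alphaMult (by norm_num) (by positivity) ?_ ?_ hα1
      · rw [div_lt_iff₀ hn0]
        nlinarith [Real.pi_pos]
      · rw [hn, ← Complex.exp_nat_mul, Complex.exp_eq_one_iff]
        refine ⟨j, ?_⟩
        have : (n : ℂ) ≠ 0 := by exact_mod_cast hn0.ne'
        push_cast
        field_simp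
    · refine hcycle (-1) hcyc ?_
      rw [hz]
      -- Rules out truncation in `⌊n / 2⌋₊ - 1`, so that `j + 1 ≤ n / 2`.
      have hfl : 1 ≤ ⌊(n : ℝ) / 2⌋₊ := by
        refine Nat.le_floor ?_
        have : (3 : ℝ) ≤ n := by exact_mod_cast hn3
        push_cast
        linarith
      have hj' : ((j + 1 : ℕ) : ℝ) ≤ n / 2 :=
        (Nat.le_floor_iff (by positivity)).1 (by omega)
      push_cast at hj'
      refine hcyc.two_le_alphaMult (by norm_num) (by positivity) ?_ ?_ hα1
      · rw [div_lt_iff₀ hn0]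
        nlinarith [Real.pi_pos]
      · have hnc : (n : ℂ) ≠ 0 := by exact_mod_cast hn0.ne'
        have : (n : ℂ) * (((2 * j + 1) * Real.pi / n : ℝ) * Complex.I)
            = j * (2 * Real.pi * Complex.I) + Real.pi * Complex.I := by
          push_cast
          field_simp
        rw [hn, ← Complex.exp_nat_mul, this, Complex.exp_add, Complex.exp_nat_mul_two_pi_mul_I,
          Complex.exp_pi_mul_I, one_mul]
    · have hdeg := degree_eq_of_iso_completeBipartiteGraph e
      have hΔeq : Δ = m := hΔ ▸ IsRegularOfDegree.maxDegree_eq G hdeg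
      have hadj := φ.alphaMult_eq_adjMult_of_regular hdeg hα1 z
      have hzμ : (z - α * (m : ℕ)) / ((1 - α : ℝ) : ℂ) = 0 := by
        rw [div_eq_zero_iff]
        left
        rw [hz, hm]
        push_cast
        ring
      rw [hzμ] at hadj
      have h1 := φ.adjMult_add_rank 0
      rw [zero_smul, sub_zero] at h1
      have h2 := φ.rank_adjMatrix_le_two e hsw
      -- Only this upper bound is needed; `hbound` supplies the opposite inequality.
      have hr2 : r ≤ 2 := by omega
      have h3 : r * (Δ - 1) ≤ 2 * (Δ - 1) := Nat.mul_le_mul_right _ hr2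
      omega
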